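/- Fix a prime base $b$, let $\mathbb N=\{1,2,\dots\}$, and let $\alpha\ge 2$ be an integer. For a symmetric positive semi-definite kernel $K:[0,1)\times[0,1)\to\mathbb R$ let $H(K)$ denote its reproducing kernel Hilbert space of real functions on $[0,1)$. For $k\in\mathbb N$ let $a_1>\dots>a_{\#k}\ge 0$ be the positions of the nonzero base-$b$ digits of $k=\sum_\ell \mathsf k_\ell b^\ell$, put $\mu_m(k)=\sum_{\ell=1}^{\min(m,\#k)}(a_\ell+1)$ and $\mu_m(0)=0$ for integers $m\ge0$, and let $k'$ be $k$ with its leading digit removed ($0'=0$, $k''=(k')'$). Let $\oplus,\ominus$ be digit-wise addition and subtraction modulo $b$ of the base-$b$ digit sequences of points of $[0,1)$ (expansions not ending in infinitely many digits $b-1$), and for a digit sequence $d=(\mathsf d_1,\mathsf d_2,\dots)$ let $\mathrm{wal}_k(d)=\exp\big(\tfrac{2\pi\sqrt{-1}}{b}\sum_{\ell\ge0}\mathsf k_\ell\,\mathsf d_{\ell+1}\big)$. (So $\mathrm{wal}_k(x\ominus x')$ is evaluated at the sequence of digit differences.) Define $$\dot K_\alpha(x,x')=\sum_{k\in\mathbb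 N} b^{-2\mu_\alpha(k)}\,\mathrm{wal}_k(x\ominus x'),\qquad \ddot K_{\alpha,\tau,\zeta}(x,x')=\sum_{k\in\mathbb N} b^{-\mu_\alpha(k)-\tau\mu_1(k')-\zeta\mu_{\alpha-2}(k'')}\,\mathrm{wal}_k(x\ominus x'),$$ $$\check K_\alpha(x,x')=\sum_{l=1}^{\alpha}\frac{B_l(x)B_l(x')}{(l!)^2}+\frac{(-1)^{\alpha+1}}{(2\alpha)!}B_{2\alpha}\big((x-x')\bmod 1\big),\qquad \check K_\alpha^{\mathrm{DSI}}(x,x')=\int_0^1\check K_\alpha(x\oplus\sigma,x'\oplus\sigma)\,\mathrm d\sigma,$$ where $B_l$ are the Bernoulli polynomials; in the last integral $x\oplus\sigma$ is read as a real number. The coefficients of the series for $\dot K_\alpha$ are summable, and so are those of the series for $\ddot K_{\alpha,\tau,\zeta}$ whenever $\tau>-1$ and $\zeta\ge-1$. We say that $\ddot K_{\alpha,\tau,\zeta}$ is well defined if its coefficients are summable, i.e. if its series converges on the diagonal. Then: 1. $H(\check K_\alpha^{\mathrm{DSI}})\subseteq H(\dot K_\alpha)$. 2. For all real $\tau<1$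 and $\zeta\le1$ for which $\ddot K_{\alpha,\tau,\zeta}$ is well defined, $H(\dot K_\alpha)\subseteq H(\ddot K_{\alpha,\tau,\zeta})$ and $H(\check K_\alpha)\subseteq H(\ddot K_{\alpha,\tau,\zeta})$. 3. For all real $\tau_2\le\tau_1<1$ and $\zeta_2\le\zeta_1\le1$ for which $\ddot K_{\alpha,\tau_2,\zeta_2}$ is well defined, $H(\ddot K_{\alpha,\tau_1,\zeta_1})\subseteq H(\ddot K_{\alpha,\tau_2,\zeta_2})$. -/

import Mathlib

open scoped Nat

noncomputable section

namespace DSI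

/-- The domain `[0,1)` of the kernels. -/
abbrev Unit01 : Type := Set.Ico (0 : ℝ) 1

/-- The reproducing kernel Hilbert space `H(K)` of a real kernel `K`, as a set of functions on `X`:
`f ∈ H(K)` if `f` belongs to a Hilbert space of real functions on `X` with continuous point
evaluations whose reproducing kernel is `K`.  (For symmetric positive semi-definite `K` this space
exists and is unique; if `K` is not of this kind, the set is empty.) -/
def rkhs {X : Type} (K : X → X → ℝ) : Set (X → ℝ) :=
  {f | ∃ (H : Type) (_ : NormedAddCommGroup H) (_ : InnerProductSpace ℝ H)
      (_ : CompleteSpace H) (_ : RKHS ℝ H X ℝ),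
      (∀ x y, RKHS.kernel H x y 1 = K x y) ∧ ∃ g : H, ⇑g = f}

/-- `H(K)` for a kernel on `[0,1)` given by a formula on `ℝ`: only its values on `[0,1)` matter. -/
def rkhs01 (K : ℝ → ℝ → ℝ) : Set (Unit01 → ℝ) :=
  rkhs fun x y : Unit01 => K x y

/-- The `k`-th Walsh function in base `b` at a sequence `(d₀, d₁, …)` of base `b` digits, standing
for the point `∑ d_ℓ b^(-ℓ-1)`.  The digit of index `ℓ` of `k` is `k / b ^ ℓ % b`; it is zero for
`ℓ > Nat.log b k`. -/
def walsh (b k : ℕ) (d : ℕ → Fin b) : ℂ :=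
  Complex.exp (2 * Real.pi * Complex.I / b *
    ∑ ℓ ∈ Finset.range (Nat.log b k + 1), (((k / b ^ ℓ % b) * (d ℓ : ℕ) : ℕ) : ℂ))

/-- Digit-wise addition `x ⊕ y` modulo `b` of points of `[0,1)`, as a real number.  The expansions
of `x` and `y` are those that do not end in infinitely many digits `b - 1`. -/
def digitAdd (b : ℕ) [NeZero b] (x y : ℝ) : ℝ :=
  Real.ofDigits (Real.digits x b + Real.digits y b)

/-- Digit-wise subtraction `x ⊖ y` modulo `b` of points of `[0,1)`, as a sequence of digits. -/
def digitSub (b : ℕ) [NeZero b] (x y : ℝ) : ℕ → Fin b :=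
  Real.digits x b - Real.digits y b

/-- `k'`: the number `k` with its leading (nonzero) base `b` digit removed; `0' = 0`. -/
def dropLead (b k : ℕ) : ℕ :=
  k % b ^ Nat.log b k

/-- The Dick weight `μ_α(k) = ∑_{ℓ=1}^{min(α,#k)} (a_ℓ + 1)`, where `a₁ > a₂ > … > a_{#k}` are the
positions of the nonzero base `b` digits of `k`.  Here `a₁ = Nat.log b k` for `k ≠ 0`, and
`a₂ > … > a_{#k}` are the positions belonging to `k'`. -/
def mu (b : ℕ) : ℕ → ℕ → ℕ
  | 0, _ => 0
  | α + 1, k => if k = 0 then 0 else (Nat.log b k + 1) + mu b α (dropLead b k)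

/-- The squared weight `ṙ_α²(k) = b^(-2 μ_α(k))`. -/
def dotWeightSq (b α k : ℕ) : ℝ :=
  (b : ℝ) ^ (-2 * (mu b α k : ℝ))

/-- The squared weight `r̈_{α,τ,ζ}²(k) = b^(-μ_α(k) - τ μ_1(k') - ζ μ_{α-2}(k''))` for `α ≥ 2`. -/
def ddotWeightSq (b α : ℕ) (τ ζ : ℝ) (k : ℕ) : ℝ :=
  (b : ℝ) ^ (-(mu b α k : ℝ) - τ * mu b 1 (dropLead b k)
    - ζ * mu b (α - 2) (dropLead b (dropLead b k)))

/-- The kernel `∑_{k ≥ 1} w(k) wal_k(x ⊖ y)`.  For the weights used here the sum is real: they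
depend only on the positions of the nonzero digits of `k`, so the terms come in conjugate pairs. -/
def walshKernel (b : ℕ) [NeZero b] (w : ℕ → ℝ) (x y : ℝ) : ℝ :=
  (∑' k : ℕ+, (w k : ℂ) * walsh b k (digitSub b x y)).re

/-- The kernel `K̇_α`. -/
def dotKernel (b : ℕ) [NeZero b] (α : ℕ) : ℝ → ℝ → ℝ :=
  walshKernel b (dotWeightSq b α)

/-- The kernel `K̈_{α,τ,ζ}`. -/
def ddotKernel (b : ℕ) [NeZero b] (α : ℕ) (τ ζ : ℝ) : ℝ → ℝ → ℝ :=
  walshKernel b (ddotWeightSq b α τ ζ)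

/-- The kernel `Ǩ_α(x,y) = ∑_{l=1}^α B_l(x) B_l(y) / (l!)²
+ (-1)^(α+1) / (2α)! B_{2α}((x-y) mod 1)` of the Sobolev space of order `α` of functions on `[0,1)`
with integral zero. -/
def sobolevKernel (α : ℕ) (x y : ℝ) : ℝ :=
  ∑ l ∈ Finset.Icc 1 α, bernoulliFun l x * bernoulliFun l y / ((l ! : ℕ) : ℝ) ^ 2
    + (-1) ^ (α + 1) / (((2 * α)! : ℕ) : ℝ) * bernoulliFun (2 * α) (Int.fract (x - y))

/-- The associated digitally-shift-invariant kernel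
`K^DSI(x,y) = ∫₀¹ K(x ⊕ σ, y ⊕ σ) dσ`. -/
def dsiKernel (b : ℕ) [NeZero b] (K : ℝ → ℝ → ℝ) (x y : ℝ) : ℝ :=
  ∫ σ in Set.Ico (0 : ℝ) 1, K (digitAdd b x σ) (digitAdd b y σ)

end DSI

end

/-! Everything reduces to comparing quadratic forms: if `K ≤ C K'` as forms and `K'` is symmetric
and positive semi-definite, then `H(K) ⊆ H(K')` (`rkhs_subset_of_quadForm_le`). A Walsh series
kernel is diagonal: its form is `∑ w(k) |S_k|²` with `S_k = ∑ c(x) wal_k(x)`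
(`hasSum_quadForm_walshKernel`), so inclusions between such kernels are comparisons of weights.

The Sobolev kernel is a sum of squares of features: the polynomials `B_l / l!`, and an average over
the translates of the periodised `B_α / α!` (`sobolevKernel_eq`). Their Walsh coefficients are
`O(b^(-μ_α(k)))`, uniformly in the translate, because each derivative pays for one nonzero digit of
`k` (`WalshDecay.of_hasDerivWithinAt`). Averaging over digital shifts kills the off-diagonal terms
by Parseval and leaves `b^(-2μ_α(k)) |S_k|²`, the form of `K̇_α`. Without the average,
Cauchy–Schwarz is used after factoring `b^(-2μ_α(k))` into the weights with parameters `(-τ,-ζ)` and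
`(τ,ζ)`; the first is summable since `-τ > -1` and `-ζ ≥ -1`.

The estimates are made on the grid of mesh `b⁻ⁿ`, where Walsh expansions are finite and exact, so
pointwise convergence of Walsh series is never needed. The coefficient of index `0`, absent from the
kernels, is `O(b⁻ⁿ)` there, and continuity of the Sobolev kernel permits `n → ∞`. -/

namespace DSI

/-! ### Inclusions of reproducing kernel Hilbert spaces -/

/-- The quadratic form `∑ c(x) c(y) K(x,y)` of a kernel on finitely supported families. -/
noncomputable def quadForm {X : Type} (K : X → X → ℝ) (s : Finset X) (c : X → ℝ) : ℝ :=
  ∑ x ∈ s, ∑ y ∈ s, c x * c y * K x y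

/-- A functional dominated by the norm of a linear map into a Hilbert space is represented by a
vector of that space. -/
theorem exists_inner_eq_of_abs_le {V H : Type*} [AddCommGroup V] [Module ℝ V]
    [NormedAddCommGroup H] [InnerProductSpace ℝ H] [CompleteSpace H]
    (T : V →ₗ[ℝ] H) (L : V →ₗ[ℝ] ℝ) (C : ℝ) (h : ∀ v, |L v| ≤ C * ‖T v‖) :
    ∃ g : H, ∀ v, inner ℝ g (T v) = L v := by
  have hker : LinearMap.ker T ≤ LinearMap.ker L := by
    intro v hv
    have := h v
    rw [LinearMap.mem_ker.1 hv, norm_zero, mul_zero] at this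
    exact LinearMap.mem_ker.2 (abs_eq_zero.1 (le_antisymm this (abs_nonneg _)))
  -- The functional factors through the range of `T`. That range need not be closed, hence
  -- Hahn–Banach before Riesz.
  let L₁ : LinearMap.range T →ₗ[ℝ] ℝ :=
    ((LinearMap.ker T).liftQ L hker).comp (T.quotKerEquivRange.symm : _ →ₗ[ℝ] _)
  have hL₁ : ∀ v, L₁ ⟨T v, LinearMap.mem_range_self T v⟩ = L v := by
    intro v
    have : T.quotKerEquivRange.symm ⟨T v, LinearMap.mem_range_self T v⟩
        = (LinearMap.ker T).mkQ v := T.quotKerEquivRange_symm_apply_image v _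
    simp [L₁, this]
  let L₂ : StrongDual ℝ (LinearMap.range T) := L₁.mkContinuous C (by
    rintro ⟨_, v, rfl⟩
    rw [hL₁]
    exact h v)
  obtain ⟨g, hg, -⟩ := exists_extension_norm_eq _ L₂
  refine ⟨(InnerProductSpace.toDual ℝ H).symm g, fun v => ?_⟩
  rw [InnerProductSpace.toDual_symm_apply, hg ⟨T v, LinearMap.mem_range_self T v⟩]
  exact hL₁ v

/-- The squared norm of a combination of kernel functions is the quadratic form of the kernel. -/
theorem norm_sum_kerFun_sq {X H : Type} [NormedAddCommGroup H] [InnerProductSpace ℝ H]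
    [CompleteSpace H] [RKHS ℝ H X ℝ] {K : X → X → ℝ}
    (hk : ∀ x y, RKHS.kernel H x y 1 = K x y) (s : Finset X) (c : X → ℝ) :
    ‖∑ x ∈ s, c x • RKHS.kerFun H x (1 : ℝ)‖ ^ 2 = quadForm K s c := by
  rw [← real_inner_self_eq_norm_sq]
  simp only [sum_inner, inner_sum, quadForm,
    real_inner_smul_left, real_inner_smul_right, RKHS.kerFun_inner, RKHS.kerFun_apply, hk]
  rw [Finset.sum_comm]
  refine Finset.sum_congr rfl fun x _ => Finset.sum_congr rfl fun y _ => ?_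
  simp
  ring

/-- A symmetric positive semi-definite kernel `K` has a reproducing kernel Hilbert space, which
contains every function `f` such that `f ⊗ f ≤ C K` for some `C`. -/
theorem mem_rkhs_of_sq_le {X : Type} {K : X → X → ℝ} (hsymm : ∀ x y, K x y = K y x)
    (hpos : ∀ s c, 0 ≤ quadForm K s c) {f : X → ℝ} (C : ℝ) (hC : 0 ≤ C)
    (hf : ∀ s c, (∑ x ∈ s, c x * f x) ^ 2 ≤ C * quadForm K s c) : f ∈ rkhs K := by
  -- `RKHS.OfKernel` takes operator-valued kernels, so scalars become multiplication operators on
  -- `ℝ`.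
  let M : Matrix X X (ℝ →L[ℝ] ℝ) := .of fun x y => K x y • ContinuousLinearMap.id ℝ ℝ
  have hM : ∀ x y v, M x y v = K x y * v := fun x y v => by simp [M]
  have hps : M.PosSemidef := by
    have key := (RKHS.posSemidef_tfae (K := M)).out 0 2
    rw [key]
    refine ⟨?_, fun vv => ?_⟩
    · ext x y
      refine ext_inner_right ℝ fun w => ?_
      rw [Matrix.conjTranspose_apply, ContinuousLinearMap.star_eq_adjoint,
        ContinuousLinearMap.adjoint_inner_left, hM, hM, hsymm x y]
      simp
      ring
    · have := hpos vv.support vv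
      simp only [quadForm] at this
      simp only [Finsupp.sum, hM, RCLike.re_to_real]
      refine this.trans_eq (Finset.sum_congr rfl fun x _ => Finset.sum_congr rfl fun y _ => ?_)
      rw [hsymm x y]
      simp
      ring
  have : Fact M.PosSemidef := ⟨hps⟩
  have hk : ∀ x y, RKHS.kernel (RKHS.OfKernel M) x y 1 = K x y := fun x y => by
    rw [RKHS.OfKernel.kernel_ofKernel, hM, mul_one]
  -- A vector `g` representing `L` through `T` has `g x = ⟨g, k_x⟩ = f x`, by testing on
  -- `Finsupp.single x 1`.
  let T : (X →₀ ℝ) →ₗ[ℝ] RKHS.OfKernel M :=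
    Finsupp.linearCombination ℝ fun x => RKHS.kerFun (RKHS.OfKernel M) x (1 : ℝ)
  let L : (X →₀ ℝ) →ₗ[ℝ] ℝ := Finsupp.linearCombination ℝ f
  have hT : ∀ u, ‖T u‖ ^ 2 = quadForm K u.support u := by
    intro u
    simpa [T, Finsupp.linearCombination_apply, Finsupp.sum] using
      norm_sum_kerFun_sq hk u.support u
  have hL : ∀ u, |L u| ≤ √C * ‖T u‖ := by
    intro u
    refine abs_le_of_sq_le_sq ?_ (by positivity)
    rw [mul_pow, Real.sq_sqrt hC, hT]
    simpa [L, Finsupp.linearCombination_apply, Finsupp.sum] using hf u.support u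
  obtain ⟨g, hg⟩ := exists_inner_eq_of_abs_le T L (√C) hL
  refine ⟨RKHS.OfKernel M, inferInstance, inferInstance, inferInstance, inferInstance, hk, g, ?_⟩
  ext x
  simpa [T, L] using hg (Finsupp.single x 1)

/-- Domination of kernels, `K ≤ C K'`, implies inclusion of the Hilbert spaces. -/
theorem rkhs_subset_of_quadForm_le {X : Type} {K K' : X → X → ℝ} (hsymm : ∀ x y, K' x y = K' y x)
    (hpos : ∀ s c, 0 ≤ quadForm K' s c) (C : ℝ) (hC : 0 ≤ C)
    (h : ∀ s c, quadForm K s c ≤ C * quadForm K' s c) : rkhs K ⊆ rkhs K' := by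
  rintro f ⟨H, _, _, _, _, hk, g, rfl⟩
  -- The constant is Cauchy–Schwarz for `∑ c(x) g(x) = ⟨v, g⟩`, where `‖v‖²` is the form of `K`.
  refine mem_rkhs_of_sq_le hsymm hpos (‖g‖ ^ 2 * C) (by positivity) fun s c => ?_
  let v : H := ∑ x ∈ s, c x • RKHS.kerFun H x (1 : ℝ)
  have h1 : inner ℝ v g = ∑ x ∈ s, c x * g x := by
    simp [v, sum_inner, real_inner_smul_left]
  have h2 : ‖v‖ ^ 2 = quadForm K s c := norm_sum_kerFun_sq hk s c
  have h3 : inner ℝ v g ^ 2 ≤ (‖v‖ * ‖g‖) ^ 2 := by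
    rw [← sq_abs (inner ℝ v g)]
    exact pow_le_pow_left₀ (abs_nonneg _) (abs_real_inner_le_norm v g) 2
  rw [← h1]
  refine h3.trans ?_
  rw [mul_pow, h2, mul_comm, mul_assoc]
  exact mul_le_mul_of_nonneg_left (h s c) (by positivity)

/-! ### Walsh functions -/

/-- The primitive `b`-th root of unity `exp(2πi/b)`. -/
noncomputable def rootOfUnity (b : ℕ) : ℂ := Complex.exp (2 * Real.pi * Complex.I / b)

theorem isPrimitiveRoot_rootOfUnity {b : ℕ} (hb : 1 < b) : IsPrimitiveRoot (rootOfUnity b) b :=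
  Complex.isPrimitiveRoot_exp b (by omega)

theorem norm_rootOfUnity {b : ℕ} (hb : 1 < b) : ‖rootOfUnity b‖ = 1 :=
  (isPrimitiveRoot_rootOfUnity hb).norm'_eq_one (by omega)

theorem mul_conj_of_norm_eq_one {z : ℂ} (hz : ‖z‖ = 1) : z * (starRingEnd ℂ) z = 1 := by
  rw [Complex.mul_conj, Complex.normSq_eq_norm_sq, hz]
  norm_num

theorem sum_rootOfUnity_mul_conj {b : ℕ} (hb : 1 < b) {d e : ℕ} (hd : d < b) (he : e < b) :
    ∑ κ ∈ Finset.range b, rootOfUnity b ^ (κ * d) * (starRingEnd ℂ) (rootOfUnity b ^ (κ * e))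
      = if d = e then (b : ℂ) else 0 := by
  set w := rootOfUnity b
  have hw : w * (starRingEnd ℂ) w = 1 := mul_conj_of_norm_eq_one (norm_rootOfUnity hb)
  have hwe : ∀ e : ℕ, w ^ e * (starRingEnd ℂ) w ^ e = 1 := fun e => by
    rw [← mul_pow, hw, one_pow]
  have hwb : w ^ b = 1 := (isPrimitiveRoot_rootOfUnity hb).pow_eq_one
  set r := w ^ d * (starRingEnd ℂ) w ^ e with hr
  have hsum : ∑ κ ∈ Finset.range b, w ^ (κ * d) * (starRingEnd ℂ) (w ^ (κ * e))
      = ∑ κ ∈ Finset.range b, r ^ κ := by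
    refine Finset.sum_congr rfl fun κ _ => ?_
    rw [map_pow, hr, mul_pow, ← pow_mul, ← pow_mul, mul_comm d, mul_comm e]
  rw [hsum]
  split_ifs with h
  · subst h
    simp [hr, hwe]
  · have hr1 : r ≠ 1 := by
      intro h1
      refine h ((isPrimitiveRoot_rootOfUnity hb).pow_inj hd he ?_)
      calc w ^ d = r * w ^ e := by rw [hr, mul_assoc, mul_comm ((starRingEnd ℂ) w ^ e), hwe, mul_one]
        _ = w ^ e := by rw [h1, one_mul]
    have hrb : r ^ b = 1 := by
      rw [hr, mul_pow, ← pow_mul, ← pow_mul, mul_comm d, mul_comm e, pow_mul, pow_mul, ← map_pow,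
        hwb]
      simp
    rw [geom_sum_eq hr1, hrb]
    simp

theorem digit_eq_zero_of_lt {b k n ℓ : ℕ} (hb : 1 < b) (hk : k < b ^ n) (h : n ≤ ℓ) :
    k / b ^ ℓ % b = 0 := by
  rw [Nat.div_eq_of_lt (hk.trans_le (Nat.pow_le_pow_right hb.le h)), Nat.zero_mod]

theorem digit_mod_pow {b k n ℓ : ℕ} (h : ℓ < n) : k % b ^ n / b ^ ℓ % b = k / b ^ ℓ % b := by
  obtain ⟨m, rfl⟩ := Nat.exists_eq_add_of_lt h
  rw [add_assoc, pow_add, Nat.mod_mul_right_div_self, pow_succ', Nat.mod_mul_right_mod]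

/-- Frees the digit range from `Nat.log b k`: higher digits contribute factors `1`, so different `k`
can share one length `n`. -/
theorem walsh_eq_prod {b : ℕ} (hb : 1 < b) {k n : ℕ} (hk : k < b ^ n) (d : ℕ → Fin b) :
    walsh b k d = ∏ ℓ ∈ Finset.range n, rootOfUnity b ^ ((k / b ^ ℓ % b) * (d ℓ : ℕ)) := by
  have key : ∀ N, k < b ^ N → ∀ M, k < b ^ M → N ≤ M →
      ∏ ℓ ∈ Finset.range N, rootOfUnity b ^ ((k / b ^ ℓ % b) * (d ℓ : ℕ))
        = ∏ ℓ ∈ Finset.range M, rootOfUnity b ^ ((k / b ^ ℓ % b) * (d ℓ : ℕ)) := by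
    intro N hN M _ hNM
    refine Finset.prod_subset (Finset.range_subset_range.2 hNM) fun ℓ _ hℓ => ?_
    rw [digit_eq_zero_of_lt hb hN (by simpa using hℓ)]
    simp
  have hlog : k < b ^ (Nat.log b k + 1) := Nat.lt_pow_succ_log_self hb k
  have : walsh b k d = ∏ ℓ ∈ Finset.range (Nat.log b k + 1),
      rootOfUnity b ^ ((k / b ^ ℓ % b) * (d ℓ : ℕ)) := by
    rw [walsh, Finset.mul_sum, Complex.exp_sum]
    refine Finset.prod_congr rfl fun ℓ _ => ?_
    rw [rootOfUnity, ← Complex.exp_nat_mul, mul_comm]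
  rw [this]
  rcases le_total (Nat.log b k + 1) n with h | h
  · exact key _ hlog _ hk h
  · exact (key _ hk _ hlog h).symm

theorem walsh_zero {b : ℕ} (hb : 1 < b) (d : ℕ → Fin b) : walsh b 0 d = 1 := by
  rw [walsh_eq_prod hb (n := 0) (by simp)]
  simp

theorem norm_walsh {b : ℕ} (hb : 1 < b) (k : ℕ) (d : ℕ → Fin b) : ‖walsh b k d‖ = 1 := by
  rw [walsh_eq_prod hb (Nat.lt_pow_succ_log_self hb k), norm_prod]
  exact Finset.prod_eq_one fun ℓ _ => by rw [norm_pow, norm_rootOfUnity hb, one_pow]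

theorem walsh_congr {b : ℕ} (hb : 1 < b) {k n : ℕ} (hk : k < b ^ n) {d e : ℕ → Fin b}
    (h : ∀ ℓ < n, d ℓ = e ℓ) : walsh b k d = walsh b k e := by
  rw [walsh_eq_prod hb hk, walsh_eq_prod hb hk]
  exact Finset.prod_congr rfl fun ℓ hℓ => by rw [h ℓ (Finset.mem_range.1 hℓ)]

theorem walsh_mul_pow_add {b : ℕ} (hb : 1 < b) {κ k n : ℕ} (hκ : κ < b) (hk : k < b ^ n)
    (d : ℕ → Fin b) :
    walsh b (κ * b ^ n + k) d = rootOfUnity b ^ (κ * (d n : ℕ)) * walsh b k d := by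
  have hlt : κ * b ^ n + k < b ^ (n + 1) := by
    calc κ * b ^ n + k < (κ + 1) * b ^ n := by rw [add_mul, one_mul]; omega
      _ ≤ b ^ (n + 1) := by rw [pow_succ']; exact Nat.mul_le_mul_right _ hκ
  have hmod : (κ * b ^ n + k) % b ^ n = k := by
    rw [Nat.mul_add_mod', Nat.mod_eq_of_lt hk]
  have hdiv : (κ * b ^ n + k) / b ^ n % b = κ := by
    rw [mul_comm, Nat.mul_add_div (by positivity), Nat.div_eq_of_lt hk, add_zero,
      Nat.mod_eq_of_lt hκ]
  rw [walsh_eq_prod hb hlt, walsh_eq_prod hb hk, Finset.prod_range_succ, hdiv, mul_comm]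
  congr 1
  refine Finset.prod_congr rfl fun ℓ hℓ => ?_
  rw [← digit_mod_pow (k := κ * b ^ n + k) (Finset.mem_range.1 hℓ), hmod]

/-- Carry-free addition is addition in `ℤ/b` digit by digit, and the root of unity has order `b`. -/
theorem walsh_add {b : ℕ} [NeZero b] (hb : 1 < b) (k : ℕ) (d e : ℕ → Fin b) :
    walsh b k (d + e) = walsh b k d * walsh b k e := by
  have hk := Nat.lt_pow_succ_log_self hb k
  rw [walsh_eq_prod hb hk, walsh_eq_prod hb hk, walsh_eq_prod hb hk, ← Finset.prod_mul_distrib]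
  refine Finset.prod_congr rfl fun ℓ _ => ?_
  rw [← pow_add, ← mul_add, Pi.add_apply, Fin.val_add, mul_comm, pow_mul, mul_comm _ (_ + _),
    pow_mul, ← pow_eq_pow_mod _ (isPrimitiveRoot_rootOfUnity hb).pow_eq_one]

theorem walsh_sub {b : ℕ} [NeZero b] (hb : 1 < b) (k : ℕ) (d e : ℕ → Fin b) :
    walsh b k (d - e) = walsh b k d * (starRingEnd ℂ) (walsh b k e) := by
  have h := walsh_add hb k (d - e) e
  rw [sub_add_cancel] at h
  rw [h, mul_assoc, mul_conj_of_norm_eq_one (norm_walsh hb k e), mul_one]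

theorem sum_range_mul {M : Type*} [AddCommMonoid M] (f : ℕ → M) (m n : ℕ) :
    ∑ k ∈ Finset.range (m * n), f k
      = ∑ i ∈ Finset.range m, ∑ j ∈ Finset.range n, f (i * n + j) := by
  induction m with
  | zero => simp
  | succ m ih => rw [add_mul, one_mul, Finset.sum_range_add, ih, Finset.sum_range_succ]

/-- The base `b` digits of `j / b ^ n` for `j < b ^ n`; only those of index below `n` matter. -/
def gridDigits (b : ℕ) [NeZero b] (n j : ℕ) : ℕ → Fin b :=
  fun ℓ => Fin.ofNat b (j / b ^ (n - 1 - ℓ))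

theorem gridDigits_succ_of_lt {b : ℕ} [NeZero b] {n j d ℓ : ℕ} (hd : d < b) (hℓ : ℓ < n) :
    gridDigits b (n + 1) (j * b + d) ℓ = gridDigits b n j ℓ := by
  have h : n + 1 - 1 - ℓ = (n - 1 - ℓ) + 1 := by omega
  rw [gridDigits, gridDigits, h, pow_succ', ← Nat.div_div_eq_div_mul, mul_comm j,
    Nat.mul_add_div (by omega), Nat.div_eq_of_lt hd, add_zero]

theorem gridDigits_succ_self {b : ℕ} [NeZero b] {n j d : ℕ} (hd : d < b) :
    ((gridDigits b (n + 1) (j * b + d) n : Fin b) : ℕ) = d := by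
  simp [gridDigits, Nat.mod_eq_of_lt hd]

/-- Splitting the top digit off `k` and `l` and the last digit off the grid point factors the sum
into the same sum for `n` and a character sum over `ℤ/b`. -/
theorem sum_walsh_mul_conj {b : ℕ} [NeZero b] (hb : 1 < b) (n : ℕ) :
    ∀ {k l : ℕ}, k < b ^ n → l < b ^ n →
    ∑ j ∈ Finset.range (b ^ n),
      walsh b k (gridDigits b n j) * (starRingEnd ℂ) (walsh b l (gridDigits b n j))
        = if k = l then (b : ℂ) ^ n else 0 := by
  induction n with
  | zero =>
    intro k l hk hl
    obtain rfl : k = 0 := by simpa using hk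
    obtain rfl : l = 0 := by simpa using hl
    simp [walsh_zero hb]
  | succ n ih =>
    intro k l hk hl
    have hpos : 0 < b ^ n := by positivity
    have hk1 := Nat.mod_lt k hpos
    have hl1 := Nat.mod_lt l hpos
    have hk2 : k / b ^ n < b := Nat.div_lt_of_lt_mul (by rwa [← pow_succ])
    have hl2 : l / b ^ n < b := Nat.div_lt_of_lt_mul (by rwa [← pow_succ])
    have hk3 : k = k / b ^ n * b ^ n + k % b ^ n := (Nat.div_add_mod' k _).symm
    have hl3 : l = l / b ^ n * b ^ n + l % b ^ n := (Nat.div_add_mod' l _).symm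
    have hterm : ∀ j, ∀ d ∈ Finset.range b,
        walsh b k (gridDigits b (n + 1) (j * b + d)) *
            (starRingEnd ℂ) (walsh b l (gridDigits b (n + 1) (j * b + d)))
          = (walsh b (k % b ^ n) (gridDigits b n j) *
            (starRingEnd ℂ) (walsh b (l % b ^ n) (gridDigits b n j))) *
            (rootOfUnity b ^ (d * (k / b ^ n)) *
              (starRingEnd ℂ) (rootOfUnity b ^ (d * (l / b ^ n)))) := by
      intro j d hd
      have hd := Finset.mem_range.1 hd
      conv_lhs => rw [hk3, hl3]
      rw [walsh_mul_pow_add hb hk2 hk1, walsh_mul_pow_add hb hl2 hl1, gridDigits_succ_self hd,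
        walsh_congr hb hk1 fun ℓ hℓ => gridDigits_succ_of_lt hd hℓ,
        walsh_congr hb hl1 fun ℓ hℓ => gridDigits_succ_of_lt hd hℓ, map_mul, mul_comm d,
        mul_comm d]
      ring
    rw [pow_succ, sum_range_mul]
    simp_rw [Finset.sum_congr rfl (hterm _), ← Finset.mul_sum,
      sum_rootOfUnity_mul_conj hb hk2 hl2]
    rw [← Finset.sum_mul, ih hk1 hl1]
    by_cases h : k = l
    · simp [h, pow_succ]
    · rw [if_neg h]
      by_cases h1 : k % b ^ n = l % b ^ n
      · have h2 : k / b ^ n ≠ l / b ^ n := fun h2 => h (by rw [hk3, hl3, h1, h2])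
        simp [h2]
      · simp [h1]

/-- Parseval's identity on the grid of mesh `b⁻ⁿ`. -/
theorem sum_norm_sq_walsh_sum {b : ℕ} [NeZero b] (hb : 1 < b) (n : ℕ) (c : ℕ → ℂ) :
    ∑ j ∈ Finset.range (b ^ n),
      ‖∑ k ∈ Finset.range (b ^ n), c k * walsh b k (gridDigits b n j)‖ ^ 2
        = (b : ℝ) ^ n * ∑ k ∈ Finset.range (b ^ n), ‖c k‖ ^ 2 := by
  have h : ∀ z : ℂ, ((‖z‖ ^ 2 : ℝ) : ℂ) = z * (starRingEnd ℂ) z := fun z => by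
    rw [Complex.mul_conj, Complex.normSq_eq_norm_sq]
  apply Complex.ofReal_injective
  rw [Complex.ofReal_sum, Complex.ofReal_mul, Complex.ofReal_sum]
  simp_rw [h, map_sum, Finset.sum_mul_sum]
  rw [Finset.sum_comm, Finset.mul_sum]
  refine Finset.sum_congr rfl fun k hk => ?_
  rw [Finset.sum_comm]
  have hk := Finset.mem_range.1 hk
  have hl : ∀ l ∈ Finset.range (b ^ n), ∑ j ∈ Finset.range (b ^ n),
      c k * walsh b k (gridDigits b n j) * (starRingEnd ℂ) (c l * walsh b l (gridDigits b n j))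
        = if k = l then (b : ℂ) ^ n * (c k * (starRingEnd ℂ) (c l)) else 0 := by
    intro l hl
    have := sum_walsh_mul_conj hb n hk (Finset.mem_range.1 hl)
    calc _ = (c k * (starRingEnd ℂ) (c l)) * ∑ j ∈ Finset.range (b ^ n),
        walsh b k (gridDigits b n j) * (starRingEnd ℂ) (walsh b l (gridDigits b n j)) := by
          rw [Finset.mul_sum]
          refine Finset.sum_congr rfl fun j _ => ?_
          rw [map_mul]
          ring
      _ = _ := by
          rw [this]
          split_ifs <;> ring
  rw [Finset.sum_congr rfl hl]
  simp [hk]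

/-! ### Discrete Walsh coefficients -/

/-- The discrete Walsh coefficient of index `k` of the function `y ↦ F (x + y)` on the grid of mesh
`b⁻ⁿ`. -/
noncomputable def walshCoeff (b k : ℕ) (F : ℝ → ℝ) : ℕ → ℝ → ℂ
  | 0, x => F x
  | n + 1, x => (b : ℂ)⁻¹ * ∑ d ∈ Finset.range b,
      (starRingEnd ℂ) (rootOfUnity b ^ ((k / b ^ n % b) * d)) *
        walshCoeff b k F n (x + d * ((b : ℝ) ^ (n + 1))⁻¹)

theorem walshCoeff_congr {b k l : ℕ} (F : ℝ → ℝ) {n : ℕ}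
    (h : ∀ ℓ < n, k / b ^ ℓ % b = l / b ^ ℓ % b) (x : ℝ) :
    walshCoeff b k F n x = walshCoeff b l F n x := by
  induction n generalizing x with
  | zero => rfl
  | succ n ih =>
    simp only [walshCoeff]
    rw [h n n.lt_succ_self]
    simp_rw [ih fun ℓ hℓ => h ℓ (hℓ.trans n.lt_succ_self)]

/-- With `n = Nat.log b k` this replaces `k` by `dropLead b k`, which drives the recursion over
nonzero digits. -/
theorem walshCoeff_mod {b k : ℕ} (F : ℝ → ℝ) (n : ℕ) (x : ℝ) :
    walshCoeff b (k % b ^ n) F n x = walshCoeff b k F n x :=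
  walshCoeff_congr F (fun _ hℓ => digit_mod_pow hℓ) x

/-- The value of a function at a grid point is recovered from its discrete Walsh coefficients. -/
theorem sum_walsh_mul_walshCoeff {b : ℕ} [NeZero b] (hb : 1 < b) (F : ℝ → ℝ) (n : ℕ)
    (d : ℕ → Fin b) (x : ℝ) :
    ∑ k ∈ Finset.range (b ^ n), walsh b k d * walshCoeff b k F n x
      = (F (x + ∑ i ∈ Finset.range n, Real.ofDigitsTerm d i) : ℝ) := by
  induction n generalizing x with
  | zero => simp [walsh_zero hb, walshCoeff]
  | succ n ih =>
    rw [pow_succ', sum_range_mul]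
    have hterm : ∀ κ ∈ Finset.range b, ∀ k ∈ Finset.range (b ^ n),
        walsh b (κ * b ^ n + k) d * walshCoeff b (κ * b ^ n + k) F (n + 1) x
        = (b : ℂ)⁻¹ * ∑ e ∈ Finset.range b,
          (rootOfUnity b ^ (κ * (d n : ℕ)) * (starRingEnd ℂ) (rootOfUnity b ^ (κ * e))) *
          (walsh b k d * walshCoeff b k F n (x + e * ((b : ℝ) ^ (n + 1))⁻¹)) := by
      intro κ hκ k hk
      have hκ := Finset.mem_range.1 hκ
      have hk := Finset.mem_range.1 hk
      have hdiv : (κ * b ^ n + k) / b ^ n % b = κ := by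
        rw [mul_comm, Nat.mul_add_div (by positivity), Nat.div_eq_of_lt hk, add_zero,
          Nat.mod_eq_of_lt hκ]
      have hmod : (κ * b ^ n + k) % b ^ n = k := by
        rw [Nat.mul_add_mod', Nat.mod_eq_of_lt hk]
      rw [walsh_mul_pow_add hb hκ hk, walshCoeff, hdiv, mul_left_comm, Finset.mul_sum]
      congr 1
      refine Finset.sum_congr rfl fun e _ => ?_
      rw [← walshCoeff_mod, hmod]
      ring
    rw [Finset.sum_congr rfl fun κ hκ => Finset.sum_congr rfl (hterm κ hκ)]
    simp_rw [← Finset.mul_sum]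
    have hswap : ∀ κ ∈ Finset.range b, ∑ k ∈ Finset.range (b ^ n), ∑ e ∈ Finset.range b,
          (rootOfUnity b ^ (κ * (d n : ℕ)) * (starRingEnd ℂ) (rootOfUnity b ^ (κ * e))) *
          (walsh b k d * walshCoeff b k F n (x + e * ((b : ℝ) ^ (n + 1))⁻¹))
        = ∑ e ∈ Finset.range b,
          (rootOfUnity b ^ (κ * (d n : ℕ)) * (starRingEnd ℂ) (rootOfUnity b ^ (κ * e))) *
          (F (x + e * ((b : ℝ) ^ (n + 1))⁻¹ + ∑ i ∈ Finset.range n, Real.ofDigitsTerm d i) : ℝ) := by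
      intro κ _
      rw [Finset.sum_comm]
      refine Finset.sum_congr rfl fun e _ => ?_
      rw [← Finset.mul_sum, ih]
    rw [Finset.sum_congr rfl hswap, Finset.sum_comm]
    simp_rw [← Finset.sum_mul]
    -- Summing over the top digit `κ` first keeps only the shift `e` equal to the digit `d n`.
    have hdelta : ∀ e ∈ Finset.range b, (∑ κ ∈ Finset.range b, rootOfUnity b ^ (κ * (d n : ℕ)) *
          (starRingEnd ℂ) (rootOfUnity b ^ (κ * e))) *
          ((F (x + e * ((b : ℝ) ^ (n + 1))⁻¹ + ∑ i ∈ Finset.range n, Real.ofDigitsTerm d i) : ℝ) : ℂ)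
        = if (d n : ℕ) = e then (b : ℂ) * (F (x + e * ((b : ℝ) ^ (n + 1))⁻¹ +
          ∑ i ∈ Finset.range n, Real.ofDigitsTerm d i) : ℝ) else 0 := by
      intro e he
      rw [sum_rootOfUnity_mul_conj hb (d n).isLt (Finset.mem_range.1 he)]
      split_ifs <;> simp
    rw [Finset.sum_congr rfl hdelta, Finset.sum_ite_eq, if_pos (Finset.mem_range.2 (d n).isLt),
      ← mul_assoc, inv_mul_cancel₀ (by exact_mod_cast NeZero.ne b), one_mul,
      Finset.sum_range_succ, Real.ofDigitsTerm]
    congr 2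
    ring

/-! ### Decay of Walsh coefficients -/

/-- The mean of `y ↦ F (x + y)` over the grid of mesh `b⁻ⁿ`. -/
noncomputable def gridMean (b : ℕ) (F : ℝ → ℝ) : ℕ → ℝ → ℝ
  | 0, x => F x
  | n + 1, x => (b : ℝ)⁻¹ * ∑ d ∈ Finset.range b, gridMean b F n (x + d * ((b : ℝ) ^ (n + 1))⁻¹)

theorem walshCoeff_zero {b : ℕ} (F : ℝ → ℝ) (n : ℕ) (x : ℝ) :
    walshCoeff b 0 F n x = gridMean b F n x := by
  induction n generalizing x with
  | zero => rfl
  | succ n ih => simp [walshCoeff, gridMean, ih]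

theorem norm_walshCoeff_le_gridMean {b : ℕ} (hb : 1 < b) (k : ℕ) (F : ℝ → ℝ) (n : ℕ) (x : ℝ) :
    ‖walshCoeff b k F n x‖ ≤ gridMean b (fun y => |F y|) n x := by
  induction n generalizing x with
  | zero => simp [walshCoeff, gridMean]
  | succ n ih =>
    simp only [walshCoeff, gridMean]
    rw [norm_mul, norm_inv, Complex.norm_natCast]
    refine mul_le_mul_of_nonneg_left ((norm_sum_le _ _).trans (Finset.sum_le_sum fun d _ => ?_))
      (by positivity)
    rw [norm_mul, Complex.norm_conj, norm_pow, norm_rootOfUnity hb, one_pow, one_mul]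
    exact ih _

theorem mean_le_of_forall_le {b : ℕ} (hb : 1 < b) {f : ℕ → ℝ} {M : ℝ} (h : ∀ d < b, f d ≤ M) :
    (b : ℝ)⁻¹ * ∑ d ∈ Finset.range b, f d ≤ M := by
  have : ∑ d ∈ Finset.range b, f d ≤ b * M := by
    simpa using Finset.sum_le_card_nsmul (Finset.range b) f M fun d hd => h d (Finset.mem_range.1 hd)
  have hb0 : (0 : ℝ) < b := by positivity
  rwa [inv_mul_le_iff₀ hb0]

/-- The invariant of all inductions on the level: a base point in `[0, b⁻ⁿ]` keeps its whole grid of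
mesh `b⁻ⁿ` inside `[0,1]`. -/
theorem add_digit_mem_Icc {b n d : ℕ} (hd : d < b) {x : ℝ}
    (hx : x ∈ Set.Icc 0 ((b : ℝ) ^ (n + 1))⁻¹) :
    x + d * ((b : ℝ) ^ (n + 1))⁻¹ ∈ Set.Icc 0 ((b : ℝ) ^ n)⁻¹ := by
  have hb0 : (0 : ℝ) < b := by exact_mod_cast (Nat.zero_le d).trans_lt hd
  have hd1 : (d : ℝ) + 1 ≤ b := by exact_mod_cast hd
  have hh : (0 : ℝ) < ((b : ℝ) ^ (n + 1))⁻¹ := by positivity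
  have hbh : b * ((b : ℝ) ^ (n + 1))⁻¹ = ((b : ℝ) ^ n)⁻¹ := by
    rw [pow_succ]
    field_simp
  refine ⟨by have := hx.1; positivity, ?_⟩
  rw [← hbh]
  nlinarith [hx.2]

theorem gridMean_le {b : ℕ} (hb : 1 < b) {F : ℝ → ℝ} {M : ℝ} (hF : ∀ y ∈ Set.Icc (0 : ℝ) 1, F y ≤ M)
    (n : ℕ) {x : ℝ} (hx : x ∈ Set.Icc 0 ((b : ℝ) ^ n)⁻¹) : gridMean b F n x ≤ M := by
  induction n generalizing x with
  | zero => exact hF x (by simpa using hx)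
  | succ n ih => exact mean_le_of_forall_le hb fun d hd => ih (add_digit_mem_Icc hd hx)

theorem gridMean_shift_sub {b : ℕ} (Φ F : ℝ → ℝ) (c h : ℝ) (n : ℕ) (x : ℝ) :
    gridMean b (fun y => Φ (y + h) - Φ y - c * F y) n x
      = gridMean b Φ n (x + h) - gridMean b Φ n x - c * gridMean b F n x := by
  induction n generalizing x with
  | zero => rfl
  | succ n ih =>
    simp only [gridMean]
    rw [mul_left_comm c, ← mul_sub, ← mul_sub, Finset.mul_sum _ _ c, ← Finset.sum_sub_distrib,
      ← Finset.sum_sub_distrib]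
    congr 1
    refine Finset.sum_congr rfl fun d _ => ?_
    rw [ih, add_right_comm x h]

/-- Shifting the grid by one mesh width drops its first point `x` and adds `x + 1`; the rest
telescopes. -/
theorem gridMean_add_mesh_sub {b : ℕ} (hb : 1 < b) (g : ℝ → ℝ) (n : ℕ) (x : ℝ) :
    gridMean b g n (x + ((b : ℝ) ^ n)⁻¹) - gridMean b g n x
      = ((b : ℝ) ^ n)⁻¹ * (g (x + 1) - g x) := by
  induction n generalizing x with
  | zero => simp [gridMean]
  | succ n ih =>
    have hb0 : (b : ℝ) ≠ 0 := by positivity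
    have hbh : b * ((b : ℝ) ^ (n + 1))⁻¹ = ((b : ℝ) ^ n)⁻¹ := by
      rw [pow_succ]
      field_simp
    have htel := Finset.sum_range_sub
      (fun d : ℕ => gridMean b g n (x + d * ((b : ℝ) ^ (n + 1))⁻¹)) b
    rw [hbh, Nat.cast_zero, zero_mul, add_zero, ih] at htel
    simp only [gridMean]
    rw [← mul_sub, ← Finset.sum_sub_distrib]
    have : ∀ d : ℕ, x + ((b : ℝ) ^ (n + 1))⁻¹ + d * ((b : ℝ) ^ (n + 1))⁻¹
        = x + (d + 1 : ℕ) * ((b : ℝ) ^ (n + 1))⁻¹ := fun d => by push_cast; ring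
    simp_rw [this]
    rw [htel, pow_succ]
    field_simp

theorem monotone_gridMean {b : ℕ} {g : ℝ → ℝ} (hg : Monotone g) (n : ℕ) :
    Monotone (gridMean b g n) := by
  induction n with
  | zero => exact hg
  | succ n ih =>
    intro x y hxy
    simp only [gridMean]
    gcongr
    exact ih (by linarith)

theorem walshCoeff_shift_sub {b k : ℕ} (Φ F : ℝ → ℝ) (h : ℝ) (n : ℕ) (x : ℝ) :
    walshCoeff b k (fun y => Φ (y + h) - F y) n x
      = walshCoeff b k Φ n (x + h) - walshCoeff b k F n x := by
  induction n generalizing x with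
  | zero => simp [walshCoeff]
  | succ n ih =>
    simp only [walshCoeff]
    rw [← mul_sub, ← Finset.sum_sub_distrib]
    congr 1
    refine Finset.sum_congr rfl fun d _ => ?_
    rw [ih, add_right_comm x h, mul_sub]

/-- A finer coefficient is a mean of coarser ones with unimodular factors, so bounds persist under
refinement. It therefore suffices to treat the level just above the leading digit. -/
theorem norm_walshCoeff_le_of_succ {b k : ℕ} (hb : 1 < b) (F : ℝ → ℝ) {B : ℝ} {m : ℕ}
    (h : ∀ x ∈ Set.Icc 0 ((b : ℝ) ^ m)⁻¹, ‖walshCoeff b k F m x‖ ≤ B) {n : ℕ} (hmn : m ≤ n) :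
    ∀ x ∈ Set.Icc 0 ((b : ℝ) ^ n)⁻¹, ‖walshCoeff b k F n x‖ ≤ B := by
  induction n, hmn using Nat.le_induction with
  | base => exact h
  | succ n _ ih =>
    intro x hx
    simp only [walshCoeff]
    rw [norm_mul, norm_inv, Complex.norm_natCast]
    refine (mul_le_mul_of_nonneg_left (norm_sum_le _ _) (by positivity)).trans
      (mean_le_of_forall_le hb fun d hd => ?_)
    rw [norm_mul, Complex.norm_conj, norm_pow, norm_rootOfUnity hb, one_pow, one_mul]
    exact ih _ (add_digit_mem_Icc hd hx)

/-- If the digit of index `n` of `k` is nonzero, the coefficient is controlled by differences. -/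
theorem norm_walshCoeff_succ_le {b k n : ℕ} (hb : 1 < b) (hk : k / b ^ n % b ≠ 0) (F : ℝ → ℝ)
    {x B : ℝ} (h : ∀ d < b, ‖walshCoeff b k F n (x + d * ((b : ℝ) ^ (n + 1))⁻¹)
      - walshCoeff b k F n x‖ ≤ B) : ‖walshCoeff b k F (n + 1) x‖ ≤ B := by
  -- A nontrivial character has sum zero, so the value at the unshifted base point may be subtracted
  -- from every term.
  have hzero : ∑ d ∈ Finset.range b, (starRingEnd ℂ) (rootOfUnity b ^ ((k / b ^ n % b) * d)) = 0 := by
    have := sum_rootOfUnity_mul_conj hb (d := 0) (e := k / b ^ n % b) (by omega)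
      (Nat.mod_lt _ (by omega))
    simpa [hk.symm, mul_comm] using this
  have : walshCoeff b k F (n + 1) x = (b : ℂ)⁻¹ * ∑ d ∈ Finset.range b,
      (starRingEnd ℂ) (rootOfUnity b ^ ((k / b ^ n % b) * d)) *
        (walshCoeff b k F n (x + d * ((b : ℝ) ^ (n + 1))⁻¹) - walshCoeff b k F n x) := by
    simp_rw [mul_sub]
    rw [Finset.sum_sub_distrib, ← Finset.sum_mul, hzero, zero_mul, sub_zero]
    rfl
  rw [this, norm_mul, norm_inv, Complex.norm_natCast]
  refine (mul_le_mul_of_nonneg_left (norm_sum_le _ _) (by positivity)).trans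
    (mean_le_of_forall_le hb fun d hd => ?_)
  rw [norm_mul, Complex.norm_conj, norm_pow, norm_rootOfUnity hb, one_pow, one_mul]
  exact h d hd

theorem leading_digit_ne_zero {b k : ℕ} (hb : 1 < b) (hk : k ≠ 0) :
    k / b ^ Nat.log b k % b ≠ 0 := by
  have h1 : 0 < k / b ^ Nat.log b k := Nat.div_pos (Nat.pow_log_le_self b hk) (by positivity)
  have h2 : k / b ^ Nat.log b k < b :=
    Nat.div_lt_of_lt_mul (by rw [← pow_succ]; exact Nat.lt_pow_succ_log_self hb k)
  rw [Nat.mod_eq_of_lt h2]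
  omega

theorem dropLead_lt {b : ℕ} (hb : 1 < b) (k : ℕ) : dropLead b k < b ^ Nat.log b k :=
  Nat.mod_lt _ (by positivity)

theorem mul_inv_pow_succ_le {b d : ℕ} (hd : d < b) (n : ℕ) :
    (d : ℝ) * ((b : ℝ) ^ (n + 1))⁻¹ ≤ ((b : ℝ) ^ n)⁻¹ := by
  have hb : (0 : ℝ) < b := by exact_mod_cast (Nat.zero_le d).trans_lt hd
  have := (add_digit_mem_Icc (n := n) hd (x := 0) ⟨le_rfl, by positivity⟩).2
  rwa [zero_add] at this

/-- For increasing `g` the absolute increments are the increments, and their grid mean is at most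
the telescoped increment over one mesh width. No continuity is needed, so the floor function is
admitted. -/
theorem norm_walshCoeff_le_of_monotone {b k : ℕ} (hb : 1 < b) (hk : k ≠ 0) {g : ℝ → ℝ}
    (hg : Monotone g) (hg1 : ∀ x, g (x + 1) = g x + 1) {n : ℕ} (hkn : k < b ^ n) :
    ∀ x ∈ Set.Icc 0 ((b : ℝ) ^ n)⁻¹,
      ‖walshCoeff b k g n x‖ ≤ ((b : ℝ) ^ Nat.log b k)⁻¹ := by
  refine norm_walshCoeff_le_of_succ hb g (m := Nat.log b k + 1) (fun x _ => ?_)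
    (Nat.log_lt_of_lt_pow hk hkn)
  refine norm_walshCoeff_succ_le hb (leading_digit_ne_zero hb hk) g fun d hd => ?_
  set a := Nat.log b k
  have hh : 0 ≤ (d : ℝ) * ((b : ℝ) ^ (a + 1))⁻¹ := by positivity
  rw [← walshCoeff_shift_sub]
  refine (norm_walshCoeff_le_gridMean hb _ _ _ _).trans ?_
  -- The term `0 * g y` only matches the shape of `gridMean_shift_sub`.
  have habs : (fun y => |g (y + d * ((b : ℝ) ^ (a + 1))⁻¹) - g y|)
      = fun y => g (y + d * ((b : ℝ) ^ (a + 1))⁻¹) - g y - 0 * g y := by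
    ext y
    rw [abs_of_nonneg (sub_nonneg.2 (hg (by linarith)))]
    ring
  rw [habs, gridMean_shift_sub, zero_mul, sub_zero]
  have h1 := monotone_gridMean (b := b) hg a
    (add_le_add_right (mul_inv_pow_succ_le hd a) x)
  have h2 := gridMean_add_mesh_sub hb g a x
  rw [hg1, add_sub_cancel_left, mul_one] at h2
  linarith

/-- The Walsh coefficients of `F` are bounded by `M b^(-μ_m(k))`, on all grids. -/
def WalshDecay (b m : ℕ) (M : ℝ) (F : ℝ → ℝ) : Prop :=
  ∀ n k, k < b ^ n → ∀ x ∈ Set.Icc 0 ((b : ℝ) ^ n)⁻¹,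
    ‖walshCoeff b k F n x‖ ≤ M * ((b : ℝ) ^ mu b m k)⁻¹

theorem WalshDecay.mono {b m : ℕ} {M N : ℝ} {F : ℝ → ℝ} (h : WalshDecay b m M F) (hMN : M ≤ N) :
    WalshDecay b m N F := fun n k hk x hx =>
  (h n k hk x hx).trans (mul_le_mul_of_nonneg_right hMN (by positivity))

theorem norm_walshCoeff_le {b : ℕ} (hb : 1 < b) {M : ℝ} {F : ℝ → ℝ}
    (hF : ∀ y ∈ Set.Icc (0 : ℝ) 1, |F y| ≤ M) {n : ℕ} (k : ℕ) {x : ℝ}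
    (hx : x ∈ Set.Icc 0 ((b : ℝ) ^ n)⁻¹) : ‖walshCoeff b k F n x‖ ≤ M :=
  (norm_walshCoeff_le_gridMean hb k F n x).trans (gridMean_le hb hF n hx)

theorem mu_index_zero (b m : ℕ) : mu b m 0 = 0 := by
  cases m <;> simp [mu]

theorem WalshDecay.of_bounded {b : ℕ} (hb : 1 < b) {M : ℝ} {F : ℝ → ℝ}
    (hF : ∀ y ∈ Set.Icc (0 : ℝ) 1, |F y| ≤ M) : WalshDecay b 0 M F := by
  intro n k _ x hx
  simpa [mu] using norm_walshCoeff_le hb hF k hx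

theorem continuous_walshCoeff {b k : ℕ} {F : ℝ → ℝ} (hF : Continuous F) (n : ℕ) :
    Continuous (walshCoeff b k F n) := by
  induction n with
  | zero => exact Complex.continuous_ofReal.comp hF
  | succ n ih =>
    simp only [walshCoeff]
    exact continuous_const.mul (continuous_finsetSum _ fun d _ =>
      continuous_const.mul (ih.comp (continuous_id.add continuous_const)))

/-- Right derivatives are used because `perBern 2` has corners at the integers. -/
theorem hasDerivWithinAt_walshCoeff {b k : ℕ} {F F' : ℝ → ℝ}
    (hF : ∀ x, HasDerivWithinAt F (F' x) (Set.Ici x) x) (n : ℕ) (x : ℝ) :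
    HasDerivWithinAt (walshCoeff b k F n) (walshCoeff b k F' n x) (Set.Ici x) x := by
  induction n generalizing x with
  | zero => exact (hF x).ofReal_comp
  | succ n ih =>
    simp only [walshCoeff]
    refine HasDerivWithinAt.const_mul _ (HasDerivWithinAt.fun_sum fun d _ =>
      HasDerivWithinAt.const_mul _ ?_)
    set c : ℝ := d * ((b : ℝ) ^ (n + 1))⁻¹
    have h1 : HasDerivWithinAt (fun y : ℝ => y + c) 1 (Set.Ici x) x :=
      (hasDerivWithinAt_id x _).add_const c
    have h2 := (ih (x + c)).scomp x h1 (t' := Set.Ici (x + c)) fun y hy => by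
      simpa using hy
    rw [one_smul] at h2
    exact h2

/-- One derivative buys one digit. With leading position `a`, the coefficient at `k` is controlled
by increments, over lengths at most `b⁻ᵃ`, of the coefficient at `k'`; the mean value inequality
brings in the coefficient of `F'` at `k'`. The factor `b` is the loss from `b⁻ᵃ` to `b^(-(a+1))`. -/
theorem WalshDecay.of_hasDerivWithinAt {b m : ℕ} (hb : 1 < b) {M : ℝ} {F F' : ℝ → ℝ}
    (hcont : Continuous F) (hderiv : ∀ x, HasDerivWithinAt F (F' x) (Set.Ici x) x)
    (hbound : ∀ y ∈ Set.Icc (0 : ℝ) 1, |F y| ≤ M) (hF' : WalshDecay b m M F') :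
    WalshDecay b (m + 1) (M * b) F := by
  have hM : 0 ≤ M := (abs_nonneg _).trans (hbound 0 (by simp))
  have hb1 : (1 : ℝ) < b := by exact_mod_cast hb
  intro n k hkn
  by_cases hk : k = 0
  · intro x hx
    subst hk
    rw [mu_index_zero, pow_zero, inv_one, mul_one]
    exact (norm_walshCoeff_le hb hbound 0 hx).trans (le_mul_of_one_le_right hM hb1.le)
  refine norm_walshCoeff_le_of_succ hb F (m := Nat.log b k + 1) (fun x hx => ?_)
    (Nat.log_lt_of_lt_pow hk hkn)
  refine norm_walshCoeff_succ_le hb (leading_digit_ne_zero hb hk) F fun d hd => ?_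
  have hdrop : ∀ (G : ℝ → ℝ) y, walshCoeff b k G (Nat.log b k) y
      = walshCoeff b (dropLead b k) G (Nat.log b k) y := fun G y => (walshCoeff_mod G _ y).symm
  rw [hdrop, hdrop, mu, if_neg hk]
  set a := Nat.log b k
  set h := ((b : ℝ) ^ (a + 1))⁻¹ with hh
  have hh0 : 0 < h := by positivity
  have hmem := add_digit_mem_Icc hd hx
  have hmv := norm_image_sub_le_of_norm_deriv_right_le_segment
    (f := walshCoeff b (dropLead b k) F a) (f' := walshCoeff b (dropLead b k) F' a)
    (a := x) (b := x + d * h) (C := M * ((b : ℝ) ^ mu b m (dropLead b k))⁻¹)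
    (continuous_walshCoeff hcont a).continuousOn
    (fun y _ => hasDerivWithinAt_walshCoeff hderiv a y)
    (fun y hy => hF' a _ (dropLead_lt hb k) y ⟨hx.1.trans hy.1, hy.2.le.trans hmem.2⟩)
    (x + d * h) ⟨le_add_of_nonneg_right (by positivity), le_rfl⟩
  refine hmv.trans ?_
  rw [add_sub_cancel_left]
  refine (mul_le_mul_of_nonneg_left (mul_inv_pow_succ_le hd a) (by positivity)).trans (le_of_eq ?_)
  rw [pow_add, pow_succ]
  field_simp

/-- With `h = b⁻ⁿ`, `Φ(y+h) - Φ(y)` equals `h F(y)` up to `L h²`, and the grid mean of the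
increments of `Φ` telescopes to a multiple of `Φ 1 - Φ 0 = 0`. The bound is needed up to `2` since
`y + h` may pass `1`. -/
theorem abs_gridMean_le_of_hasDerivWithinAt {b : ℕ} (hb : 1 < b) {L : ℝ} {Φ F F' : ℝ → ℝ}
    (hΦc : Continuous Φ) (hΦ : ∀ x, HasDerivWithinAt Φ (F x) (Set.Ici x) x)
    (hFc : Continuous F) (hF : ∀ x, HasDerivWithinAt F (F' x) (Set.Ici x) x)
    (hL : ∀ y ∈ Set.Icc (0 : ℝ) 2, |F' y| ≤ L) (hper : Φ 1 = Φ 0) (n : ℕ) :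
    |gridMean b F n 0| ≤ L * ((b : ℝ) ^ n)⁻¹ := by
  have hL0 : 0 ≤ L := (abs_nonneg _).trans (hL 0 (by simp))
  have hb1 : (1 : ℝ) < b := by exact_mod_cast hb
  set h := ((b : ℝ) ^ n)⁻¹ with hh
  have hh0 : 0 < h := by positivity
  have hh1 : h ≤ 1 := inv_le_one_of_one_le₀ (one_le_pow₀ hb1.le)
  have key : ∀ y ∈ Set.Icc (0 : ℝ) 1, |Φ (y + h) - Φ y - h * F y| ≤ L * h * h := by
    intro y hy
    have h1 : ∀ z ∈ Set.Icc y (y + h), ‖F z - F y‖ ≤ L * h := by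
      intro z hz
      refine (norm_image_sub_le_of_norm_deriv_right_le_segment hFc.continuousOn
        (fun z _ => hF z) (fun z hz => hL z ⟨hy.1.trans hz.1, ?_⟩) z hz).trans ?_
      · linarith [hz.2, hy.2]
      · exact mul_le_mul_of_nonneg_left (by linarith [hz.2]) hL0
    have h2 := norm_image_sub_le_of_norm_deriv_right_le_segment
      (f := fun z => Φ z - (z - y) * F y) (f' := fun z => F z - F y) (a := y) (b := y + h)
      (C := L * h) (by fun_prop) (fun z _ => ?_) (fun z hz => h1 z ⟨hz.1, hz.2.le⟩)
      (y + h) ⟨by linarith, le_rfl⟩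
    · simpa [sub_right_comm] using h2
    · have := (hΦ z).sub (((hasDerivWithinAt_id z (Set.Ici z)).sub_const y).mul_const (F y))
      rw [one_mul] at this
      exact this
  have h1 : |gridMean b (fun y => Φ (y + h) - Φ y - h * F y) n 0| ≤ L * h * h := by
    have hw := norm_walshCoeff_le hb key (n := n) 0 (x := 0) ⟨le_rfl, by positivity⟩
    rwa [walshCoeff_zero, Complex.norm_real] at hw
  have h2 := gridMean_add_mesh_sub hb Φ n 0
  rw [zero_add 1, hper, sub_self, mul_zero] at h2
  rw [gridMean_shift_sub, h2, zero_sub, abs_neg, abs_mul, abs_of_pos hh0] at h1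
  nlinarith

/-! ### Bernoulli functions -/

/-- The normalized Bernoulli polynomial `B_m / m!`. -/
noncomputable def bern (m : ℕ) (x : ℝ) : ℝ := bernoulliFun m x / (m ! : ℕ)

/-- The `1`-periodic extension of `B_m / m!` from `[0,1)`. -/
noncomputable def perBern (m : ℕ) (x : ℝ) : ℝ := bern m (Int.fract x)

theorem continuous_bern (m : ℕ) : Continuous (bern m) :=
  (continuous_bernoulliFun m).div_const _

theorem hasDerivAt_bern (m : ℕ) (x : ℝ) : HasDerivAt (bern (m + 1)) (bern m x) x := by
  have h := (hasDerivAt_bernoulliFun (m + 1) x).div_const (((m + 1) ! : ℕ) : ℝ)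
  rw [Nat.add_sub_cancel, Nat.factorial_succ, Nat.cast_mul,
    mul_div_mul_left _ _ (by positivity)] at h
  rw [← Nat.cast_mul, ← Nat.factorial_succ] at h
  exact h

theorem bern_zero (x : ℝ) : bern 0 x = 1 := by simp [bern]

theorem bern_one (x : ℝ) : bern 1 x = x - 1 / 2 := by simp [bern]

theorem bern_endpoints {m : ℕ} (hm : m ≠ 1) : bern m 1 = bern m 0 := by
  rw [bern, bern, bernoulliFun_endpoints_eq_of_ne_one hm]

theorem perBern_periodic (m : ℕ) : Function.Periodic (perBern m) 1 := fun x => by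
  simp [perBern]

theorem continuous_perBern {m : ℕ} (hm : m ≠ 1) : Continuous (perBern m) :=
  ContinuousOn.comp_fract'' (continuous_bern m).continuousOn (bern_endpoints hm).symm

theorem perBern_eq_bern {m : ℕ} (hm : m ≠ 1) {x : ℝ} (hx : x ∈ Set.Icc (0 : ℝ) 1) :
    perBern m x = bern m x := by
  rcases hx.2.lt_or_eq with h | rfl
  · rw [perBern, Int.fract_eq_self.2 ⟨hx.1, h⟩]
  · rw [perBern, Int.fract_one, bern_endpoints hm]

theorem hasDerivWithinAt_perBern (m : ℕ) (x : ℝ) :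
    HasDerivWithinAt (perBern (m + 1)) (perBern m x) (Set.Ici x) x := by
  have h1 : HasDerivWithinAt (fun y : ℝ => y - ⌊x⌋) 1 (Set.Ici x) x :=
    (hasDerivWithinAt_id x _).sub_const _
  have h2 : HasDerivWithinAt (fun y : ℝ => bern (m + 1) (y - ⌊x⌋)) (perBern m x) (Set.Ici x) x := by
    have := (hasDerivAt_bern m (x - ⌊x⌋)).comp_hasDerivWithinAt x h1
    rw [mul_one] at this
    exact this
  -- To the right of `x`, up to the next integer, the floor is constant and the periodisation is a
  -- translated polynomial.
  refine h2.congr_of_eventuallyEq ?_ rfl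
  have : Set.Ico x (⌊x⌋ + 1) ∈ nhdsWithin x (Set.Ici x) :=
    Ico_mem_nhdsGE (Int.lt_floor_add_one x)
  filter_upwards [this] with y hy
  have : ⌊y⌋ = ⌊x⌋ := Int.floor_eq_iff.2 ⟨(Int.floor_le x).trans hy.1, hy.2⟩
  rw [perBern, Int.fract, this]

theorem hasDerivWithinAt_perBern_add (m : ℕ) (s x : ℝ) :
    HasDerivWithinAt (fun y => perBern (m + 1) (y + s)) (perBern m (x + s)) (Set.Ici x) x := by
  have h1 : HasDerivWithinAt (fun y : ℝ => y + s) 1 (Set.Ici x) x :=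
    (hasDerivWithinAt_id x _).add_const s
  have h2 := (hasDerivWithinAt_perBern m (x + s)).scomp x h1 (t' := Set.Ici (x + s))
    fun y hy => by simpa using hy
  rw [one_smul] at h2
  exact h2

theorem exists_abs_bern_le (m : ℕ) : ∃ M, ∀ x ∈ Set.Icc (0 : ℝ) 2, |bern m x| ≤ M :=
  isCompact_Icc.exists_bound_of_continuousOn (continuous_bern m).continuousOn

theorem exists_abs_perBern_le (m : ℕ) : ∃ M, ∀ x, |perBern m x| ≤ M := by
  obtain ⟨M, hM⟩ := exists_abs_bern_le m
  exact ⟨M, fun x => hM _ ⟨Int.fract_nonneg x, by linarith [Int.fract_lt_one x]⟩⟩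

theorem measurable_perBern (m : ℕ) : Measurable (perBern m) :=
  (continuous_bern m).measurable.comp measurable_fract

theorem intervalIntegrable_perBern_add (m : ℕ) (c u v : ℝ) :
    IntervalIntegrable (fun s => perBern m (s + c)) MeasureTheory.volume u v := by
  obtain ⟨M, hM⟩ := exists_abs_perBern_le m
  have h : IntervalIntegrable (fun _ : ℝ => M) MeasureTheory.volume u v :=
    intervalIntegrable_const
  refine h.mono_fun' ((measurable_perBern m).comp (measurable_id.add_const c)).aestronglyMeasurable
    (Filter.Eventually.of_forall fun s => hM _)

theorem integral_perBern_add {m : ℕ} (hm : 2 ≤ m) (c : ℝ) : ∫ s in (0 : ℝ)..1, perBern m (s + c) = 0 := by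
  rw [intervalIntegral.integral_comp_add_right, zero_add, add_comm 1 c,
    (perBern_periodic m).intervalIntegral_add_eq c 0, zero_add]
  have : ∫ s in (0 : ℝ)..1, perBern m s = ∫ s in (0 : ℝ)..1, bern m s :=
    intervalIntegral.integral_congr fun s hs =>
      perBern_eq_bern (by omega) (by rwa [Set.uIcc_of_le zero_le_one] at hs)
  rw [this]
  simp only [bern]
  rw [intervalIntegral.integral_div, integral_bernoulliFun_eq_zero (by omega), zero_div]

/-- Integration by parts lowers the first index and raises the second. Boundary terms cancel until
`B_1`, whose endpoint values differ by `1`; that term is the right-hand side. -/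
theorem integral_bern_mul_perBern (m : ℕ) : ∀ n c,
    ∫ s in (0 : ℝ)..1, bern (m + 1) s * perBern (n + 1) (s + c)
      = (-1) ^ m * perBern (m + n + 2) c := by
  have parts : ∀ m n c, ∫ s in (0 : ℝ)..1, bern (m + 1) s * perBern (n + 1) (s + c)
      = (bern (m + 1) 1 - bern (m + 1) 0) * perBern (n + 2) c
        - ∫ s in (0 : ℝ)..1, bern m s * perBern (n + 2) (s + c) := by
    intro m n c
    have hcont : Continuous fun s => perBern (n + 2) (s + c) :=
      (continuous_perBern (by omega)).comp (continuous_id.add continuous_const)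
    rw [intervalIntegral.integral_mul_deriv_eq_deriv_mul_of_hasDeriv_right
      (continuous_bern (m + 1)).continuousOn hcont.continuousOn
      (fun x _ => (hasDerivAt_bern m x).hasDerivWithinAt)
      (fun x _ => (hasDerivWithinAt_perBern_add (n + 1) c x).mono Set.Ioi_subset_Ici_self)
      ((continuous_bern m).intervalIntegrable _ _) (intervalIntegrable_perBern_add (n + 1) c _ _),
      add_comm 1 c, perBern_periodic, zero_add, sub_mul]
  induction m with
  | zero =>
    intro n c
    rw [parts]
    simp only [bern_zero, one_mul, zero_add, bern_one]
    rw [integral_perBern_add (by omega)]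
    norm_num
  | succ m ih =>
    intro n c
    rw [parts, bern_endpoints (by omega), sub_self, zero_mul, zero_sub, ih (n + 1) c, pow_succ,
      show m + 1 + n + 2 = m + (n + 1) + 2 by ring]
    ring

/-- Turns the convolution part of the Sobolev kernel into an average of rank-one products, with the
sign matching the one in the kernel. -/
theorem integral_perBern_mul_perBern {α : ℕ} (hα : 2 ≤ α) (x y : ℝ) :
    ∫ s in (0 : ℝ)..1, perBern α (x + s) * perBern α (y + s)
      = (-1) ^ (α + 1) * perBern (2 * α) (x - y) := by
  have hper : Function.Periodic (fun s => perBern α s * perBern α (s + (x - y))) 1 := by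
    intro s
    simp only [add_right_comm s 1]
    rw [perBern_periodic, perBern_periodic]
  have h1 : ∫ s in (0 : ℝ)..1, perBern α (x + s) * perBern α (y + s)
      = ∫ s in (0 : ℝ)..1, (fun s => perBern α s * perBern α (s + (x - y))) (s + y) := by
    congr 1
    ext s
    simp only
    rw [show s + y + (x - y) = x + s by ring, add_comm s y, mul_comm]
  rw [h1, intervalIntegral.integral_comp_add_right (fun s => perBern α s * perBern α (s + (x - y))),
    zero_add, add_comm 1 y, hper.intervalIntegral_add_eq y 0, zero_add]
  have h2 : ∫ s in (0 : ℝ)..1, perBern α s * perBern α (s + (x - y))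
      = ∫ s in (0 : ℝ)..1, bern α s * perBern α (s + (x - y)) :=
    intervalIntegral.integral_congr fun s hs => by
      rw [perBern_eq_bern (by omega) (by rwa [Set.uIcc_of_le zero_le_one] at hs)]
  obtain ⟨m, rfl⟩ : ∃ m, α = m + 1 := ⟨α - 1, by omega⟩
  rw [h2, integral_bern_mul_perBern, show 2 * (m + 1) = m + m + 2 by ring, pow_add, pow_add]
  norm_num

/-- The Sobolev kernel in terms of feature functions. -/
theorem sobolevKernel_eq {α : ℕ} (hα : 2 ≤ α) (x y : ℝ) :
    sobolevKernel α x y = ∑ l ∈ Finset.Icc 1 α, bern l x * bern l y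
      + ∫ s in (0 : ℝ)..1, perBern α (x + s) * perBern α (y + s) := by
  rw [sobolevKernel, integral_perBern_mul_perBern hα, perBern, bern]
  congr 1
  · refine Finset.sum_congr rfl fun l _ => ?_
    rw [bern, bern, div_mul_div_comm, sq]
  · ring

theorem continuous_sobolevKernel {α : ℕ} (hα : 2 ≤ α) :
    Continuous fun p : ℝ × ℝ => sobolevKernel α p.1 p.2 := by
  have h : ∀ x y, sobolevKernel α x y = ∑ l ∈ Finset.Icc 1 α, bern l x * bern l y
      + (-1) ^ (α + 1) * perBern (2 * α) (x - y) := fun x y => by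
    rw [sobolevKernel_eq hα, integral_perBern_mul_perBern hα]
  simp_rw [h]
  refine Continuous.add (continuous_finsetSum _ fun l _ => ?_) (continuous_const.mul ?_)
  · exact ((continuous_bern l).comp continuous_fst).mul ((continuous_bern l).comp continuous_snd)
  · exact (continuous_perBern (by omega)).comp (continuous_fst.sub continuous_snd)

/-- The form becomes a sum and an integral of squares, so each feature function can be estimated
separately. -/
theorem sum_sobolevKernel_eq {α : ℕ} (hα : 2 ≤ α) {ι : Type*} (s : Finset ι) (c p : ι → ℝ) :
    ∑ i ∈ s, ∑ j ∈ s, c i * c j * sobolevKernel α (p i) (p j)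
      = ∑ l ∈ Finset.Icc 1 α, (∑ i ∈ s, c i * bern l (p i)) ^ 2
        + ∫ t in (0 : ℝ)..1, (∑ i ∈ s, c i * perBern α (p i + t)) ^ 2 := by
  have hsq : ∀ f : ι → ℝ, (∑ i ∈ s, c i * f i) ^ 2 = ∑ i ∈ s, ∑ j ∈ s, c i * c j * (f i * f j) := by
    intro f
    rw [sq, Finset.sum_mul_sum]
    exact Finset.sum_congr rfl fun i _ => Finset.sum_congr rfl fun j _ => by ring
  have hcont : ∀ i j, Continuous fun t => c i * c j * (perBern α (p i + t) * perBern α (p j + t)) := by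
    intro i j
    have := continuous_perBern (m := α) (by omega)
    fun_prop
  simp_rw [hsq]
  rw [intervalIntegral.integral_finsetSum fun i _ =>
    (continuous_finsetSum s fun j _ => hcont i j).intervalIntegrable _ _,
    Finset.sum_comm (s := Finset.Icc 1 α), ← Finset.sum_add_distrib]
  refine Finset.sum_congr rfl fun i _ => ?_
  rw [intervalIntegral.integral_finsetSum fun j _ => (hcont i j).intervalIntegrable _ _,
    Finset.sum_comm (s := Finset.Icc 1 α), ← Finset.sum_add_distrib]
  refine Finset.sum_congr rfl fun j _ => ?_
  rw [sobolevKernel_eq hα, mul_add, Finset.mul_sum, intervalIntegral.integral_const_mul]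

/-! ### Feature functions of the Sobolev kernel -/

/-- Polynomials have decay of every order `m`; no periodicity is involved, and the recursion on
derivatives ends at a constant. -/
theorem exists_walshDecay_bern {b : ℕ} (hb : 1 < b) (m : ℕ) :
    ∀ l, ∃ M, WalshDecay b m M (bern l) := by
  have hbd : ∀ l, ∃ M, 0 ≤ M ∧ ∀ y ∈ Set.Icc (0 : ℝ) 1, |bern l y| ≤ M := fun l => by
    obtain ⟨M, hM⟩ := exists_abs_bern_le l
    exact ⟨M, (abs_nonneg _).trans (hM 0 (by simp)),
      fun y hy => hM y ⟨hy.1, by linarith [hy.2]⟩⟩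
  induction m with
  | zero =>
    intro l
    obtain ⟨M, -, hM⟩ := hbd l
    exact ⟨M, WalshDecay.of_bounded hb hM⟩
  | succ m ih =>
    intro l
    obtain ⟨M, hM0, hM⟩ := hbd l
    cases l with
    | zero =>
      refine ⟨M * b, WalshDecay.of_hasDerivWithinAt hb (F' := fun _ => 0) (continuous_bern 0)
        (fun x => ?_) hM fun n k _ x hx => ?_⟩
      · have : bern 0 = fun _ => 1 := funext bern_zero
        rw [this]
        exact hasDerivWithinAt_const x _ 1
      · exact (norm_walshCoeff_le hb (M := 0) (by simp) k hx).trans (by positivity)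
    | succ l =>
      obtain ⟨N, hN⟩ := ih l
      exact ⟨max M N * b, WalshDecay.of_hasDerivWithinAt hb (continuous_bern _)
        (fun x => (hasDerivAt_bern l x).hasDerivWithinAt)
        (fun y hy => (hM y hy).trans (le_max_left _ _)) (hN.mono (le_max_right _ _))⟩

/-- Integrates up from the sawtooth `perBern 1`, with constants uniform in the translate `s`. -/
theorem exists_walshDecay_perBern {b : ℕ} (hb : 1 < b) (m : ℕ) :
    ∃ M, ∀ s, WalshDecay b (m + 1) M fun x => perBern (m + 1) (x + s) := by
  induction m with
  | zero =>
    have hb1 : (1 : ℝ) < b := by exact_mod_cast hb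
    refine ⟨2 * b, fun s n k hkn x hx => ?_⟩
    by_cases hk : k = 0
    · subst hk
      rw [mu_index_zero, pow_zero, inv_one, mul_one]
      refine norm_walshCoeff_le hb (fun y _ => ?_) 0 hx
      rw [zero_add, perBern, bern_one, abs_le]
      constructor <;> linarith [Int.fract_nonneg (y + s), Int.fract_lt_one (y + s)]
    -- The sawtooth is a difference of two increasing functions gaining `1` per period. Each costs
    -- `b⁻ᵃ = b · b^(-(a+1))`, whence `2 * b`.
    · have hsplit : (fun x => perBern (0 + 1) (x + s))
          = fun x => ((fun y : ℝ => y + s - 1 / 2) (x + 0)) - (fun y : ℝ => (⌊y + s⌋ : ℝ)) x := by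
        ext y
        simp only [zero_add, perBern, bern_one, Int.fract, add_zero]
        ring
      rw [hsplit, walshCoeff_shift_sub (fun y : ℝ => y + s - 1 / 2), add_zero]
      have h1 := norm_walshCoeff_le_of_monotone hb hk (g := fun y : ℝ => y + s - 1 / 2)
        (fun y z hyz => by simpa using hyz) (fun y => by ring) hkn x hx
      have h2 := norm_walshCoeff_le_of_monotone hb hk (g := fun y : ℝ => (⌊y + s⌋ : ℝ))
        (fun y z hyz => by
          simp only
          exact_mod_cast Int.floor_le_floor (by linarith))
        (fun y => by
          simp only [add_right_comm y 1 s, Int.floor_add_one]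
          push_cast
          ring) hkn x hx
      refine (norm_sub_le _ _).trans ((add_le_add h1 h2).trans (le_of_eq ?_))
      rw [mu, if_neg hk, mu, add_zero, pow_succ]
      field_simp
      norm_num
  | succ m ih =>
    obtain ⟨M, hM⟩ := exists_abs_perBern_le (m + 1 + 1)
    obtain ⟨N, hN⟩ := ih
    exact ⟨max M N * b, fun s => WalshDecay.of_hasDerivWithinAt hb
      ((continuous_perBern (by omega)).comp (continuous_id.add continuous_const))
      (fun x => hasDerivWithinAt_perBern_add _ s x)
      (fun y _ => (hM _).trans (le_max_left _ _)) ((hN s).mono (le_max_right _ _))⟩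

/-- Functions with discrete Walsh coefficients bounded by `M b^(-μ_α(k))` and with grid means
tending to zero. -/
structure IsFeature (b α : ℕ) (M : ℝ) (F : ℝ → ℝ) : Prop where
  decay : WalshDecay b α M F
  mean : ∀ n, |gridMean b F n 0| ≤ M * ((b : ℝ) ^ n)⁻¹

theorem IsFeature.mono {b α : ℕ} {M N : ℝ} {F : ℝ → ℝ} (h : IsFeature b α M F) (hMN : M ≤ N) :
    IsFeature b α N F :=
  ⟨h.decay.mono hMN, fun n => (h.mean n).trans (mul_le_mul_of_nonneg_right hMN (by positivity))⟩

theorem exists_isFeature_bern {b : ℕ} (hb : 1 < b) (α : ℕ) {l : ℕ} (hl : 1 ≤ l) :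
    ∃ M, IsFeature b α M (bern l) := by
  obtain ⟨M, hM⟩ := exists_walshDecay_bern hb α l
  obtain ⟨j, rfl⟩ : ∃ j, l = j + 1 := ⟨l - 1, by omega⟩
  obtain ⟨L, hL⟩ := exists_abs_bern_le j
  refine ⟨max M L, hM.mono (le_max_left _ _), fun n => ?_⟩
  -- The antiderivative has index at least `2`, so its endpoint values agree.
  exact abs_gridMean_le_of_hasDerivWithinAt hb (continuous_bern (j + 2))
    (fun x => (hasDerivAt_bern _ x).hasDerivWithinAt) (continuous_bern _)
    (fun x => (hasDerivAt_bern _ x).hasDerivWithinAt)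
    (fun y hy => (hL y hy).trans (le_max_right _ _)) (bern_endpoints (by omega)) n

theorem exists_isFeature_perBern {b : ℕ} (hb : 1 < b) {α : ℕ} (hα : 2 ≤ α) :
    ∃ M, ∀ s, IsFeature b α M fun x => perBern α (x + s) := by
  obtain ⟨j, rfl⟩ : ∃ j, α = j + 2 := ⟨α - 2, by omega⟩
  obtain ⟨M, hM⟩ := exists_walshDecay_perBern hb (j + 1)
  obtain ⟨L, hL⟩ := exists_abs_perBern_le (j + 1)
  refine ⟨max M L, fun s => ⟨(hM s).mono (le_max_left _ _), fun n => ?_⟩⟩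
  have hcont : ∀ m, m ≠ 1 → Continuous fun x => perBern m (x + s) := fun m hm =>
    (continuous_perBern hm).comp (continuous_id.add continuous_const)
  exact abs_gridMean_le_of_hasDerivWithinAt hb (hcont (j + 3) (by omega))
    (fun x => hasDerivWithinAt_perBern_add _ s x) (hcont (j + 2) (by omega))
    (fun x => hasDerivWithinAt_perBern_add _ s x)
    (fun y _ => (hL _).trans (le_max_right _ _))
    (by rw [add_comm 1 s, perBern_periodic, zero_add]) n

/-- A common constant for all feature functions of the Sobolev kernel. -/
theorem exists_isFeature {b : ℕ} (hb : 1 < b) {α : ℕ} (hα : 2 ≤ α) :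
    ∃ M, 0 ≤ M ∧ (∀ l ∈ Finset.Icc 1 α, IsFeature b α M (bern l)) ∧
      ∀ s, IsFeature b α M fun x => perBern α (x + s) := by
  choose! M hM using fun l (hl : 1 ≤ l) => exists_isFeature_bern hb α hl
  obtain ⟨N, hN⟩ := exists_isFeature_perBern hb hα
  refine ⟨|N| + ∑ l ∈ Finset.Icc 1 α, |M l|, by positivity, fun l hl => ?_, fun s => ?_⟩
  · refine (hM l (Finset.mem_Icc.1 hl).1).mono ?_
    have := Finset.single_le_sum (f := fun l => |M l|) (fun l _ => abs_nonneg _) hl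
    beta_reduce at this
    linarith [abs_nonneg N, le_abs_self (M l)]
  · refine (hN s).mono ?_
    have : 0 ≤ ∑ l ∈ Finset.Icc 1 α, |M l| := by positivity
    linarith [le_abs_self N]

/-! ### Weights -/

theorem dropLead_zero (b : ℕ) : dropLead b 0 = 0 := Nat.zero_mod _

/-- Makes the exponent of `ddotWeightSq` equal to `-μ_1(k) - (1+τ) μ_1(k') - (1+ζ) μ_{α-2}(k'')`,
which explains the thresholds `-1`. -/
theorem mu_eq_add {b α : ℕ} (hα : 2 ≤ α) (k : ℕ) :
    mu b α k = mu b 1 k + mu b 1 (dropLead b k) + mu b (α - 2) (dropLead b (dropLead b k)) := by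
  obtain ⟨m, rfl⟩ : ∃ m, α = m + 2 := ⟨α - 2, by omega⟩
  rw [Nat.add_sub_cancel]
  by_cases hk : k = 0
  · subst hk
    simp [mu_index_zero, dropLead_zero]
  · by_cases hk' : dropLead b k = 0
    · simp [mu, hk, hk', mu_index_zero, dropLead_zero]
    · simp [mu, hk, hk', add_assoc]

theorem dotWeightSq_nonneg (b α k : ℕ) : 0 ≤ dotWeightSq b α k := by
  rw [dotWeightSq]
  positivity

theorem ddotWeightSq_nonneg (b α : ℕ) (τ ζ : ℝ) (k : ℕ) : 0 ≤ ddotWeightSq b α τ ζ k := by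
  rw [ddotWeightSq]
  positivity

theorem dotWeightSq_eq {b : ℕ} (hb : 1 < b) (α k : ℕ) :
    dotWeightSq b α k = (((b : ℝ) ^ mu b α k)⁻¹) ^ 2 := by
  have hb0 : (0 : ℝ) < b := by positivity
  rw [dotWeightSq, show (-2 * (mu b α k : ℝ)) = -((2 * mu b α k : ℕ) : ℝ) by push_cast; ring,
    Real.rpow_neg hb0.le, Real.rpow_natCast, inv_pow, ← pow_mul, mul_comm 2]

/-- The factorisation behind Cauchy–Schwarz: `τ < 1` and `ζ ≤ 1` put `(-τ, -ζ)` in the summable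
range. -/
theorem dotWeightSq_eq_mul {b : ℕ} (hb : 1 < b) (α : ℕ) (τ ζ : ℝ) (k : ℕ) :
    dotWeightSq b α k = ddotWeightSq b α (-τ) (-ζ) k * ddotWeightSq b α τ ζ k := by
  have hb0 : (0 : ℝ) < b := by positivity
  rw [dotWeightSq, ddotWeightSq, ddotWeightSq, ← Real.rpow_add hb0]
  congr 1
  ring

theorem dotWeightSq_le_ddotWeightSq {b : ℕ} (hb : 1 < b) {α : ℕ} (hα : 2 ≤ α) {τ ζ : ℝ}
    (hτ : τ ≤ 1) (hζ : ζ ≤ 1) (k : ℕ) : dotWeightSq b α k ≤ ddotWeightSq b α τ ζ k := by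
  refine Real.rpow_le_rpow_of_exponent_le (by exact_mod_cast hb.le) ?_
  have h1 := mul_le_mul_of_nonneg_right hτ (Nat.cast_nonneg (α := ℝ) (mu b 1 (dropLead b k)))
  have h2 := mul_le_mul_of_nonneg_right hζ
    (Nat.cast_nonneg (α := ℝ) (mu b (α - 2) (dropLead b (dropLead b k))))
  have h3 := Nat.cast_nonneg (α := ℝ) (mu b 1 k)
  rw [mu_eq_add hα]
  push_cast
  linarith

theorem ddotWeightSq_anti {b : ℕ} (hb : 1 < b) (α : ℕ) {τ₁ τ₂ ζ₁ ζ₂ : ℝ}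
    (hτ : τ₂ ≤ τ₁) (hζ : ζ₂ ≤ ζ₁) (k : ℕ) :
    ddotWeightSq b α τ₁ ζ₁ k ≤ ddotWeightSq b α τ₂ ζ₂ k := by
  refine Real.rpow_le_rpow_of_exponent_le (by exact_mod_cast hb.le) ?_
  have h1 := mul_le_mul_of_nonneg_right hτ (Nat.cast_nonneg (α := ℝ) (mu b 1 (dropLead b k)))
  have h2 := mul_le_mul_of_nonneg_right hζ
    (Nat.cast_nonneg (α := ℝ) (mu b (α - 2) (dropLead b (dropLead b k))))
  linarith

theorem log_mul_pow_add {b κ n j : ℕ} (hκ0 : 0 < κ) (hκ : κ < b) (hj : j < b ^ n) :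
    Nat.log b (κ * b ^ n + j) = n := by
  refine Nat.log_eq_of_pow_le_of_lt_pow ?_ ?_
  · nlinarith [Nat.pos_of_ne_zero (fun h : b ^ n = 0 => by omega)]
  · calc κ * b ^ n + j < (κ + 1) * b ^ n := by rw [add_mul, one_mul]; omega
      _ ≤ b ^ (n + 1) := by rw [pow_succ']; exact Nat.mul_le_mul_right _ hκ

theorem mu_one_mul_pow_add {b κ n j : ℕ} (hκ0 : 0 < κ) (hκ : κ < b) (hj : j < b ^ n) :
    mu b 1 (κ * b ^ n + j) = n + 1 := by
  have hne : κ * b ^ n + j ≠ 0 := by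
    have : 0 < κ * b ^ n := Nat.mul_pos hκ0 (by omega)
    omega
  rw [mu, if_neg hne, log_mul_pow_add hκ0 hκ hj, mu]

theorem dropLead_mul_pow_add {b κ n j : ℕ} (hκ0 : 0 < κ) (hκ : κ < b) (hj : j < b ^ n) :
    dropLead b (κ * b ^ n + j) = j := by
  rw [dropLead, log_mul_pow_add hκ0 hκ hj, Nat.mul_add_mod', Nat.mod_eq_of_lt hj]

/-- Groups the new indices by leading digit; the `b - 1` blocks are counted as `b`. -/
theorem sum_range_pow_succ_le {b : ℕ} (hb : 1 < b) {f : ℕ → ℝ} {n : ℕ} {B : ℝ} (hB : 0 ≤ B)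
    (h : ∀ κ, 0 < κ → κ < b → ∑ j ∈ Finset.range (b ^ n), f (κ * b ^ n + j) ≤ B) :
    ∑ k ∈ Finset.range (b ^ (n + 1)), f k ≤ ∑ k ∈ Finset.range (b ^ n), f k + b * B := by
  obtain ⟨m, rfl⟩ : ∃ m, b = m + 1 := ⟨b - 1, by omega⟩
  rw [pow_succ', sum_range_mul, Finset.sum_range_succ', add_comm]
  simp only [zero_mul, zero_add]
  refine add_le_add_right ?_ _
  refine (Finset.sum_le_card_nsmul _ _ B fun κ hκ => h (κ + 1) κ.succ_pos ?_).trans ?_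
  · simpa using hκ
  · rw [Finset.card_range, nsmul_eq_mul]
    push_cast
    nlinarith

/-- Grouping by leading position gives `∑_{j<bⁿ} q^(μ_1(j)) ≤ (n+1)(bq)ⁿ`, where `bq ≥ 1` absorbs
the lower powers. A second grouping bounds the whole sum by `1 + ∑ (n+1) qⁿ`. -/
theorem summable_weight {b : ℕ} (hb : 1 < b) {q : ℝ} (hq0 : 0 < q) (hq1 : q < 1) (hbq : 1 ≤ b * q) :
    Summable fun k : ℕ => ((b : ℝ) ^ mu b 1 k)⁻¹ * q ^ mu b 1 (dropLead b k) := by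
  have hb0 : (0 : ℝ) < b := by positivity
  have hV : ∀ n : ℕ, ∑ j ∈ Finset.range (b ^ n), q ^ mu b 1 j ≤ ((n : ℝ) + 1) * (b * q) ^ n := by
    intro n
    induction n with
    | zero => simp [mu]
    | succ n ih =>
      refine (sum_range_pow_succ_le hb (B := b ^ n * q ^ (n + 1)) (by positivity)
        fun κ hκ0 hκ => ?_).trans ?_
      · rw [Finset.sum_congr rfl fun j hj => by
          rw [mu_one_mul_pow_add hκ0 hκ (Finset.mem_range.1 hj)]]
        simp
      · have h1 : (b : ℝ) * (b ^ n * q ^ (n + 1)) = (b * q) ^ (n + 1) := by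
          rw [mul_pow, pow_succ' (b : ℝ)]
          ring
        have h2 : (b * q) ^ n ≤ ((b : ℝ) * q) ^ (n + 1) := pow_le_pow_right₀ hbq n.le_succ
        rw [h1]
        push_cast
        nlinarith
  have hS : ∀ n : ℕ, ∑ k ∈ Finset.range (b ^ n), ((b : ℝ) ^ mu b 1 k)⁻¹ * q ^ mu b 1 (dropLead b k)
      ≤ 1 + ∑ i ∈ Finset.range n, ((i : ℝ) + 1) * q ^ i := by
    intro n
    induction n with
    | zero => simp [mu, dropLead_zero]
    | succ n ih =>
      refine (sum_range_pow_succ_le hb (B := ((b : ℝ) ^ (n + 1))⁻¹ * ((n + 1) * (b * q) ^ n))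
        (by positivity) fun κ hκ0 hκ => ?_).trans ?_
      · rw [Finset.sum_congr rfl fun j hj => by
          rw [mu_one_mul_pow_add hκ0 hκ (Finset.mem_range.1 hj),
            dropLead_mul_pow_add hκ0 hκ (Finset.mem_range.1 hj)], ← Finset.mul_sum]
        exact mul_le_mul_of_nonneg_left (hV n) (by positivity)
      · have h1 : (b : ℝ) * (((b : ℝ) ^ (n + 1))⁻¹ * ((n + 1) * (b * q) ^ n)) = (n + 1) * q ^ n := by
          rw [mul_pow, pow_succ]
          field_simp
        rw [h1, Finset.sum_range_succ]
        linarith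
  have hgeom : Summable fun i : ℕ => ((i : ℝ) + 1) * q ^ i := by
    have h1 := summable_pow_mul_geometric_of_norm_lt_one (R := ℝ) 1 (r := q)
      (by rwa [Real.norm_of_nonneg hq0.le])
    have h2 := summable_geometric_of_lt_one hq0.le hq1
    simpa [add_mul] using h1.add h2
  refine summable_of_sum_range_le (c := 1 + ∑' i : ℕ, ((i : ℝ) + 1) * q ^ i)
    (fun k => by positivity) fun n => ?_
  refine (Finset.sum_le_sum_of_subset_of_nonneg
    (Finset.range_subset_range.2 (Nat.lt_pow_self hb).le) fun k _ _ => by positivity).trans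
    ((hS n).trans ?_)
  exact add_le_add_right (hgeom.sum_le_tsum _ fun i _ => by positivity) 1

theorem summable_ddotWeightSq {b : ℕ} (hb : 1 < b) {α : ℕ} (hα : 2 ≤ α) {τ ζ : ℝ} (hτ : -1 < τ)
    (hζ : -1 ≤ ζ) : Summable fun k : ℕ+ => ddotWeightSq b α τ ζ k := by
  have hb1 : (1 : ℝ) < b := by exact_mod_cast hb
  have hb0 : (0 : ℝ) < b := by positivity
  -- Here `q = b^(-s)`; the minimum caps `s` at `1` to ensure `b q ≥ 1`. The contribution of `k''`
  -- is discarded, as `1 + ζ ≥ 0`.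
  set s := 1 + min τ 0
  have hs0 : 0 < s := by
    have : -1 < min τ 0 := lt_min hτ (by norm_num)
    linarith
  have hs1 : s ≤ 1 := by linarith [min_le_right τ 0]
  have hsum := summable_weight hb (q := (b : ℝ) ^ (-s)) (by positivity)
    (Real.rpow_lt_one_of_one_lt_of_neg hb1 (by linarith)) (by
      nth_rewrite 1 [← Real.rpow_one (b : ℝ)]
      rw [← Real.rpow_add hb0]
      exact Real.one_le_rpow hb1.le (by linarith))
  refine Summable.of_nonneg_of_le (fun k => ddotWeightSq_nonneg b α τ ζ k) (fun k => ?_)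
    (hsum.comp_injective PNat.coe_injective)
  rw [Function.comp_apply, ← Real.rpow_natCast, ← Real.rpow_natCast, ← Real.rpow_neg hb0.le,
    ← Real.rpow_mul hb0.le, ← Real.rpow_add hb0, ddotWeightSq]
  refine Real.rpow_le_rpow_of_exponent_le hb1.le ?_
  have h1 := mul_le_mul_of_nonneg_right (min_le_left τ 0)
    (Nat.cast_nonneg (α := ℝ) (mu b 1 (dropLead b k)))
  have h2 := mul_le_mul_of_nonneg_right hζ
    (Nat.cast_nonneg (α := ℝ) (mu b (α - 2) (dropLead b (dropLead b k))))
  rw [mu_eq_add hα]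
  push_cast
  simp only [s]
  linarith

theorem summable_dotWeightSq {b : ℕ} (hb : 1 < b) {α : ℕ} (hα : 2 ≤ α) :
    Summable fun k : ℕ+ => dotWeightSq b α k :=
  Summable.of_nonneg_of_le (fun k => dotWeightSq_nonneg b α k)
    (fun k => dotWeightSq_le_ddotWeightSq hb hα zero_le_one zero_le_one k)
    (summable_ddotWeightSq hb hα (τ := 0) (ζ := 0) (by norm_num) (by norm_num))

/-! ### Kernels given by Walsh series -/

/-- The combination `∑ c_i wal_k(X_i)` of values of a Walsh function. -/
noncomputable def walshSum (b : ℕ) {ι : Type*} (s : Finset ι) (c : ι → ℝ) (X : ι → ℕ → Fin b)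
    (k : ℕ) : ℂ :=
  ∑ i ∈ s, (c i : ℂ) * walsh b k (X i)

theorem hasSum_walshKernel {b : ℕ} [NeZero b] (hb : 1 < b) {w : ℕ → ℝ}
    (hw : Summable fun k : ℕ+ => w k) (x y : ℝ) :
    HasSum (fun k : ℕ+ => w k * (walsh b k (digitSub b x y)).re) (walshKernel b w x y) := by
  have hsum : Summable fun k : ℕ+ => (w k : ℂ) * walsh b k (digitSub b x y) := by
    refine Summable.of_norm ?_
    simp_rw [norm_mul, norm_walsh hb, mul_one, Complex.norm_real]
    exact hw.norm
  have := Complex.hasSum_re hsum.hasSum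
  simp_rw [Complex.re_ofReal_mul] at this
  exact this

theorem walshKernel_symm {b : ℕ} [NeZero b] (hb : 1 < b) {w : ℕ → ℝ}
    (hw : Summable fun k : ℕ+ => w k) (x y : ℝ) : walshKernel b w x y = walshKernel b w y x := by
  refine (hasSum_walshKernel hb hw x y).unique ?_
  have hre : ∀ k, (walsh b k (digitSub b x y)).re = (walsh b k (digitSub b y x)).re := fun k => by
    rw [digitSub, digitSub, walsh_sub hb, walsh_sub hb, ← Complex.conj_re, map_mul,
      Complex.conj_conj, mul_comm]
  simp_rw [hre]
  exact hasSum_walshKernel hb hw y x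

/-- Since `wal_k(x ⊖ y) = wal_k(x) · conj (wal_k(y))`, each term of the series is a rank-one form.
-/
theorem hasSum_quadForm_walshKernel {b : ℕ} [NeZero b] (hb : 1 < b) {w : ℕ → ℝ}
    (hw : Summable fun k : ℕ+ => w k) (s : Finset Unit01) (c : Unit01 → ℝ) :
    HasSum (fun k : ℕ+ => w k * ‖walshSum b s c (fun x => Real.digits x b) k‖ ^ 2)
      (quadForm (fun x y : Unit01 => walshKernel b w x y) s c) := by
  have h := hasSum_sum fun x (_ : x ∈ s) => hasSum_sum fun y (_ : y ∈ s) =>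
    (hasSum_walshKernel hb hw x y).mul_left (c x * c y)
  have hfun : (fun k : ℕ+ => w k * ‖walshSum b s c (fun x => Real.digits x b) k‖ ^ 2)
      = fun k : ℕ+ => ∑ x ∈ s, ∑ y ∈ s,
        c x * c y * (w k * (walsh b k (digitSub b x y)).re) := by
    ext k
    have hre : ‖walshSum b s c (fun x => Real.digits x b) k‖ ^ 2
        = (walshSum b s c (fun x => Real.digits x b) k *
          (starRingEnd ℂ) (walshSum b s c (fun x => Real.digits x b) k)).re := by
      rw [Complex.mul_conj, Complex.normSq_eq_norm_sq, Complex.ofReal_re]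
    rw [hre, walshSum, map_sum, Finset.sum_mul_sum, Complex.re_sum, Finset.mul_sum]
    refine Finset.sum_congr rfl fun x _ => ?_
    rw [Complex.re_sum, Finset.mul_sum]
    refine Finset.sum_congr rfl fun y _ => ?_
    rw [digitSub, walsh_sub hb, map_mul, Complex.conj_ofReal, mul_mul_mul_comm, ← Complex.ofReal_mul,
      Complex.re_ofReal_mul]
    ring
  rw [hfun]
  exact h

theorem quadForm_walshKernel_nonneg {b : ℕ} [NeZero b] (hb : 1 < b) {w : ℕ → ℝ}
    (hw0 : ∀ k, 0 ≤ w k) (hw : Summable fun k : ℕ+ => w k) (s : Finset Unit01) (c : Unit01 → ℝ) :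
    0 ≤ quadForm (fun x y : Unit01 => walshKernel b w x y) s c :=
  (hasSum_quadForm_walshKernel hb hw s c).nonneg fun k : ℕ+ =>
    mul_nonneg (hw0 k) (sq_nonneg _)

/-- Inclusion into the Hilbert space of a Walsh series kernel from domination. -/
theorem rkhs01_subset_walshKernel {b : ℕ} [NeZero b] (hb : 1 < b) {w : ℕ → ℝ}
    (hw0 : ∀ k, 0 ≤ w k) (hw : Summable fun k : ℕ+ => w k) {K : ℝ → ℝ → ℝ} (C : ℝ) (hC : 0 ≤ C)
    (h : ∀ s c, quadForm (fun x y : Unit01 => K x y) s c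
      ≤ C * quadForm (fun x y : Unit01 => walshKernel b w x y) s c) :
    rkhs01 K ⊆ rkhs01 (walshKernel b w) :=
  rkhs_subset_of_quadForm_le (fun x y => walshKernel_symm hb hw x y)
    (quadForm_walshKernel_nonneg hb hw0 hw) C hC h

theorem rkhs01_walshKernel_subset {b : ℕ} [NeZero b] (hb : 1 < b) {w v : ℕ → ℝ}
    (hv0 : ∀ k, 0 ≤ v k) (hvw : ∀ k, v k ≤ w k) (hw : Summable fun k : ℕ+ => w k) :
    rkhs01 (walshKernel b v) ⊆ rkhs01 (walshKernel b w) := by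
  have hv : Summable fun k : ℕ+ => v k :=
    Summable.of_nonneg_of_le (fun k => hv0 k) (fun k => hvw k) hw
  refine rkhs01_subset_walshKernel hb (fun k => (hv0 k).trans (hvw k)) hw 1 zero_le_one
    fun s c => ?_
  rw [one_mul]
  exact hasSum_le (fun k : ℕ+ => mul_le_mul_of_nonneg_right (hvw k) (sq_nonneg _))
    (hasSum_quadForm_walshKernel hb hv s c) (hasSum_quadForm_walshKernel hb hw s c)

open Filter Topology

/-! ### Domination of the Sobolev kernel -/

/-- The point of `[0,1]` given by the first `n` terms of a digit sequence. -/
noncomputable def truncPoint {b : ℕ} (n : ℕ) (d : ℕ → Fin b) : ℝ :=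
  ∑ i ∈ Finset.range n, Real.ofDigitsTerm d i

theorem truncPoint_congr {b n : ℕ} {d e : ℕ → Fin b} (h : ∀ ℓ < n, d ℓ = e ℓ) :
    truncPoint n d = truncPoint n e :=
  Finset.sum_congr rfl fun i hi => by
    rw [Real.ofDigitsTerm, Real.ofDigitsTerm, h i (Finset.mem_range.1 hi)]

theorem tendsto_truncPoint {b : ℕ} (d : ℕ → Fin b) :
    Tendsto (fun n => truncPoint n d) atTop (𝓝 (Real.ofDigits d)) :=
  Real.summable_ofDigitsTerm.hasSum.tendsto_sum_nat

theorem truncPoint_mem_Icc {b : ℕ} (n : ℕ) (d : ℕ → Fin b) : truncPoint n d ∈ Set.Icc (0 : ℝ) 1 :=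
  ⟨Finset.sum_nonneg fun _ _ => Real.ofDigitsTerm_nonneg,
    (Real.summable_ofDigitsTerm.sum_le_tsum _ fun _ _ => Real.ofDigitsTerm_nonneg).trans
      (Real.ofDigits_le_one d)⟩

theorem tendsto_uncurry {K : ℝ → ℝ → ℝ} (hK : Continuous fun p : ℝ × ℝ => K p.1 p.2) {u v : ℕ → ℝ}
    {x y : ℝ} (hu : Tendsto u atTop (𝓝 x)) (hv : Tendsto v atTop (𝓝 y)) :
    Tendsto (fun n => K (u n) (v n)) atTop (𝓝 (K x y)) :=
  (hK.tendsto (x, y)).comp (hu.prodMk_nhds hv)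

/-- At truncated points the Walsh expansion is finite and exact, whatever `F` is. -/
theorem sum_truncPoint_eq {b : ℕ} [NeZero b] (hb : 1 < b) (F : ℝ → ℝ) (n : ℕ) {ι : Type*}
    (s : Finset ι) (c : ι → ℝ) (X : ι → ℕ → Fin b) :
    ((∑ i ∈ s, c i * F (truncPoint n (X i)) : ℝ) : ℂ)
      = ∑ k ∈ Finset.range (b ^ n), walshCoeff b k F n 0 * walshSum b s c X k := by
  simp_rw [walshSum, Finset.mul_sum]
  rw [Finset.sum_comm, Complex.ofReal_sum]
  refine Finset.sum_congr rfl fun i _ => ?_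
  have h := sum_walsh_mul_walshCoeff hb F n (X i) 0
  rw [zero_add] at h
  rw [Complex.ofReal_mul, truncPoint, ← h, Finset.mul_sum]
  exact Finset.sum_congr rfl fun k _ => by ring

theorem walshSum_zero {b : ℕ} (hb : 1 < b) {ι : Type*} (s : Finset ι) (c : ι → ℝ)
    (X : ι → ℕ → Fin b) : walshSum b s c X 0 = ((∑ i ∈ s, c i : ℝ) : ℂ) := by
  simp [walshSum, walsh_zero hb]

/-- A common digital shift only contributes the factor `wal_k(d)`, so Parseval over the shifts
applies. -/
theorem walshSum_add {b : ℕ} [NeZero b] (hb : 1 < b) {ι : Type*} (s : Finset ι) (c : ι → ℝ)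
    (X : ι → ℕ → Fin b) (d : ℕ → Fin b) (k : ℕ) :
    walshSum b s c (fun i => X i + d) k = walshSum b s c X k * walsh b k d := by
  simp_rw [walshSum, walsh_add hb, Finset.sum_mul, mul_assoc]

theorem sum_range_succ_le_of_hasSum {f : ℕ → ℝ} (hf : ∀ k, 0 ≤ f k) {S : ℝ}
    (h : HasSum (fun k : ℕ+ => f k) S) (m : ℕ) : ∑ i ∈ Finset.range m, f (i + 1) ≤ S := by
  have h1 : Summable fun i : ℕ => f (i + 1) := summable_pnat_iff_summable_succ.1 h.summable
  rw [← h.tsum_eq, tsum_pnat_eq_tsum_succ (f := f)]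
  exact h1.sum_le_tsum _ fun i _ => hf _

theorem norm_sq_walshCoeff_le {b : ℕ} (hb : 1 < b) {α : ℕ} {M : ℝ} {F : ℝ → ℝ}
    (hF : IsFeature b α M F) {n k : ℕ} (hk : k < b ^ n) :
    ‖walshCoeff b k F n 0‖ ^ 2 ≤ M ^ 2 * dotWeightSq b α k := by
  rw [dotWeightSq_eq hb, ← mul_pow]
  exact pow_le_pow_left₀ (norm_nonneg _) (hF.decay n k hk 0 ⟨le_rfl, by positivity⟩) 2

theorem norm_sq_walshCoeff_zero_le {b : ℕ} {α : ℕ} {M : ℝ} {F : ℝ → ℝ}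
    (hF : IsFeature b α M F) (n : ℕ) :
    ‖walshCoeff b 0 F n 0‖ ^ 2 ≤ (M * ((b : ℝ) ^ n)⁻¹) ^ 2 := by
  rw [walshCoeff_zero, Complex.norm_real]
  exact pow_le_pow_left₀ (norm_nonneg _) (hF.mean n) 2

/-- Cauchy–Schwarz bound for a combination of values of a feature function. -/
theorem sq_sum_feature_le {b : ℕ} [NeZero b] (hb : 1 < b) {α : ℕ} {M : ℝ} {F : ℝ → ℝ}
    (hF : IsFeature b α M F) (n : ℕ) {ι : Type*} (s : Finset ι) (c : ι → ℝ) (X : ι → ℕ → Fin b)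
    {τ ζ E Q : ℝ} (hE : HasSum (fun k : ℕ+ => ddotWeightSq b α (-τ) (-ζ) k) E)
    (hQ : HasSum (fun k : ℕ+ => ddotWeightSq b α τ ζ k * ‖walshSum b s c X k‖ ^ 2) Q) :
    (∑ i ∈ s, c i * F (truncPoint n (X i))) ^ 2
      ≤ 2 * ((M * ((b : ℝ) ^ n)⁻¹) ^ 2 * (∑ i ∈ s, c i) ^ 2) + 2 * (M ^ 2 * E * Q) := by
  obtain ⟨m, hm⟩ : ∃ m, b ^ n = m + 1 :=
    ⟨b ^ n - 1, by have : 0 < b ^ n := by positivity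
                   omega⟩
  have hsplit := sum_truncPoint_eq hb F n s c X
  -- Index `0` is split off: the kernel series starts at `1`, and this term is only a mesh error.
  rw [hm, Finset.sum_range_succ'] at hsplit
  set T := ∑ i ∈ Finset.range m, walshCoeff b (i + 1) F n 0 * walshSum b s c X (i + 1)
  have h0 : ‖walshCoeff b 0 F n 0 * walshSum b s c X 0‖ ^ 2
      ≤ (M * ((b : ℝ) ^ n)⁻¹) ^ 2 * (∑ i ∈ s, c i) ^ 2 := by
    rw [norm_mul, mul_pow, walshSum_zero hb, Complex.norm_real, Real.norm_eq_abs, sq_abs]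
    exact mul_le_mul_of_nonneg_right (norm_sq_walshCoeff_zero_le hF n) (sq_nonneg _)
  have hE0 : 0 ≤ E := hE.nonneg fun k => ddotWeightSq_nonneg _ _ _ _ _
  have hT : ‖T‖ ^ 2 ≤ M ^ 2 * E * Q := by
    -- The factor `f` carries the dual weight with parameters `(-τ, -ζ)` and sums to at most `M² E`;
    -- `g` gives the form of the kernel.
    have hcs := Finset.sum_sq_le_sum_mul_sum_of_sq_le_mul (Finset.range m)
      (r := fun i => ‖walshCoeff b (i + 1) F n 0 * walshSum b s c X (i + 1)‖)
      (f := fun i => M ^ 2 * ddotWeightSq b α (-τ) (-ζ) (i + 1))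
      (g := fun i => ddotWeightSq b α τ ζ (i + 1) * ‖walshSum b s c X (i + 1)‖ ^ 2)
      (fun i _ => mul_nonneg (sq_nonneg _) (ddotWeightSq_nonneg _ _ _ _ _))
      (fun i _ => mul_nonneg (ddotWeightSq_nonneg _ _ _ _ _) (sq_nonneg _))
      (fun i hi => by
        have hi : i + 1 < b ^ n := by
          have := Finset.mem_range.1 hi
          omega
        rw [norm_mul, mul_pow]
        refine (mul_le_mul_of_nonneg_right (norm_sq_walshCoeff_le hb hF hi)
          (sq_nonneg _)).trans_eq ?_
        rw [dotWeightSq_eq_mul hb α τ ζ]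
        ring)
    refine (pow_le_pow_left₀ (norm_nonneg _) (norm_sum_le _ _) 2).trans (hcs.trans ?_)
    rw [← Finset.mul_sum]
    refine mul_le_mul (mul_le_mul_of_nonneg_left ?_ (sq_nonneg _)) ?_
      (Finset.sum_nonneg fun i _ => mul_nonneg (ddotWeightSq_nonneg _ _ _ _ _) (sq_nonneg _))
      (mul_nonneg (sq_nonneg _) hE0)
    · exact sum_range_succ_le_of_hasSum (fun k => ddotWeightSq_nonneg _ _ _ _ k) hE m
    · exact sum_range_succ_le_of_hasSum
        (f := fun k => ddotWeightSq b α τ ζ k * ‖walshSum b s c X k‖ ^ 2)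
        (fun k => mul_nonneg (ddotWeightSq_nonneg _ _ _ _ k) (sq_nonneg _)) hQ m
  have hnorm : (∑ i ∈ s, c i * F (truncPoint n (X i))) ^ 2
      = ‖T + walshCoeff b 0 F n 0 * walshSum b s c X 0‖ ^ 2 := by
    rw [← hsplit, Complex.norm_real, Real.norm_eq_abs, sq_abs]
  rw [hnorm]
  -- The factors `2` come from `(u + v)² ≤ 2u² + 2v²`.
  have htri := pow_le_pow_left₀ (norm_nonneg _)
    (norm_add_le T (walshCoeff b 0 F n 0 * walshSum b s c X 0)) 2
  nlinarith [sq_nonneg (‖T‖ - ‖walshCoeff b 0 F n 0 * walshSum b s c X 0‖)]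

/-- Parseval bound for the combinations of digitally shifted values of a feature function. -/
theorem sum_sq_shift_feature_le {b : ℕ} [NeZero b] (hb : 1 < b) {α : ℕ} {M : ℝ} {F : ℝ → ℝ}
    (hF : IsFeature b α M F) (n : ℕ) {ι : Type*} (s : Finset ι) (c : ι → ℝ) (X : ι → ℕ → Fin b)
    {Q : ℝ} (hQ : HasSum (fun k : ℕ+ => dotWeightSq b α k * ‖walshSum b s c X k‖ ^ 2) Q) :
    ∑ j ∈ Finset.range (b ^ n), (∑ i ∈ s, c i * F (truncPoint n (X i + gridDigits b n j))) ^ 2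
      ≤ (b : ℝ) ^ n * ((M * ((b : ℝ) ^ n)⁻¹) ^ 2 * (∑ i ∈ s, c i) ^ 2 + M ^ 2 * Q) := by
  have hterm : ∀ j, (∑ i ∈ s, c i * F (truncPoint n (X i + gridDigits b n j))) ^ 2
      = ‖∑ k ∈ Finset.range (b ^ n), (walshCoeff b k F n 0 * walshSum b s c X k) *
        walsh b k (gridDigits b n j)‖ ^ 2 := by
    intro j
    have h := sum_truncPoint_eq hb F n s c fun i => X i + gridDigits b n j
    simp_rw [walshSum_add hb, ← mul_assoc] at h
    rw [← h, Complex.norm_real, Real.norm_eq_abs, sq_abs]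
  simp_rw [hterm]
  -- Parseval leaves no cross terms, so no summable dual weight is spent here, unlike in
  -- `sq_sum_feature_le`.
  rw [sum_norm_sq_walsh_sum hb]
  refine mul_le_mul_of_nonneg_left ?_ (by positivity)
  obtain ⟨m, hm⟩ : ∃ m, b ^ n = m + 1 :=
    ⟨b ^ n - 1, by have : 0 < b ^ n := by positivity
                   omega⟩
  rw [hm, Finset.sum_range_succ', add_comm]
  refine add_le_add ?_ ?_
  · rw [norm_mul, mul_pow, walshSum_zero hb, Complex.norm_real, Real.norm_eq_abs, sq_abs]
    exact mul_le_mul_of_nonneg_right (norm_sq_walshCoeff_zero_le hF n) (sq_nonneg _)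
  · refine le_trans ?_ (mul_le_mul_of_nonneg_left (sum_range_succ_le_of_hasSum
      (f := fun k => dotWeightSq b α k * ‖walshSum b s c X k‖ ^ 2)
      (fun k => mul_nonneg (dotWeightSq_nonneg _ _ k) (sq_nonneg _)) hQ m) (sq_nonneg M))
    rw [Finset.mul_sum]
    refine Finset.sum_le_sum fun i hi => ?_
    have hi : i + 1 < b ^ n := by
      have := Finset.mem_range.1 hi
      omega
    rw [norm_mul, mul_pow, ← mul_assoc]
    exact mul_le_mul_of_nonneg_right (norm_sq_walshCoeff_le hb hF hi) (sq_nonneg _)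

theorem tendsto_mesh_error {b : ℕ} (hb : 1 < b) (M A : ℝ) :
    Tendsto (fun n : ℕ => (M * ((b : ℝ) ^ n)⁻¹) ^ 2 * A) atTop (𝓝 0) := by
  have hb1 : (1 : ℝ) < b := by exact_mod_cast hb
  have h1 : Tendsto (fun n : ℕ => ((b : ℝ) ^ n)⁻¹) atTop (𝓝 0) :=
    tendsto_inv_atTop_zero.comp (tendsto_pow_atTop_atTop_of_one_lt hb1)
  simpa using ((h1.const_mul M).pow 2).mul_const A

/-- Bound for the quadratic form of the Sobolev kernel, summed over a family of point sets, in terms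
of the feature functions. -/
theorem sum_sobolevKernel_le {b α : ℕ} (hα : 2 ≤ α) {M : ℝ}
    (hM1 : ∀ l ∈ Finset.Icc 1 α, IsFeature b α M (bern l))
    (hM2 : ∀ t, IsFeature b α M fun x => perBern α (x + t)) {ι : Type*} (s : Finset ι) (c : ι → ℝ)
    (J : Finset ℕ) (p : ℕ → ι → ℝ) {B : ℝ}
    (hB : ∀ F, IsFeature b α M F → ∑ j ∈ J, (∑ i ∈ s, c i * F (p j i)) ^ 2 ≤ B) :
    ∑ j ∈ J, ∑ x ∈ s, ∑ y ∈ s, c x * c y * sobolevKernel α (p j x) (p j y) ≤ (α + 1) * B := by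
  simp_rw [sum_sobolevKernel_eq hα]
  rw [Finset.sum_add_distrib, Finset.sum_comm, add_mul, one_mul]
  have hcont : ∀ j, Continuous fun t => (∑ i ∈ s, c i * perBern α (p j i + t)) ^ 2 := by
    intro j
    have := continuous_perBern (m := α) (by omega)
    fun_prop
  -- There are `α` polynomial features, and the periodic ones are averaged over an interval of
  -- length `1`: together `α + 1`.
  refine add_le_add ?_ ?_
  · refine (Finset.sum_le_card_nsmul _ _ B fun l hl => hB _ (hM1 l hl)).trans_eq ?_
    simp
  · rw [← intervalIntegral.integral_finsetSum fun j _ => (hcont j).intervalIntegrable _ _]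
    have hint : IntervalIntegrable (fun t => ∑ j ∈ J, (∑ i ∈ s, c i * perBern α (p j i + t)) ^ 2)
        MeasureTheory.volume 0 1 :=
      (continuous_finsetSum J fun j _ => hcont j).intervalIntegrable 0 1
    have hconst : IntervalIntegrable (fun _ : ℝ => B) MeasureTheory.volume 0 1 :=
      intervalIntegrable_const
    have hbt : ∀ t ∈ Set.Icc (0 : ℝ) 1, ∑ j ∈ J, (∑ i ∈ s, c i * perBern α (p j i + t)) ^ 2 ≤ B :=
      fun t _ => hB (fun x => perBern α (x + t)) (hM2 t)
    have hle := intervalIntegral.integral_mono_on (zero_le_one' ℝ) hint hconst hbt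
    simpa using hle

/-- The mesh error depends on `c` but vanishes as `n → ∞`, so the limiting constant is independent
of the points and coefficients. -/
theorem quadForm_sobolevKernel_le {b : ℕ} [NeZero b] (hb : 1 < b) {α : ℕ} (hα : 2 ≤ α) {τ ζ : ℝ}
    (hτ : τ < 1) (hζ : ζ ≤ 1) (hw : Summable fun k : ℕ+ => ddotWeightSq b α τ ζ k) :
    ∃ C, 0 ≤ C ∧ ∀ s c, quadForm (fun x y : Unit01 => sobolevKernel α x y) s c
      ≤ C * quadForm (fun x y : Unit01 => ddotKernel b α τ ζ x y) s c := by
  obtain ⟨M, hM0, hM1, hM2⟩ := exists_isFeature hb hα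
  have hE := (summable_ddotWeightSq hb hα (τ := -τ) (ζ := -ζ) (by linarith) (by linarith)).hasSum
  set E := ∑' k : ℕ+, ddotWeightSq b α (-τ) (-ζ) k
  have hE0 : 0 ≤ E := hE.nonneg fun k => ddotWeightSq_nonneg _ _ _ _ _
  refine ⟨(α + 1) * (2 * (M ^ 2 * E)), by positivity, fun s c => ?_⟩
  have hQ := hasSum_quadForm_walshKernel hb hw s c
  have hlim : Tendsto (fun n => ∑ x ∈ s, ∑ y ∈ s, c x * c y *
      sobolevKernel α (truncPoint n (Real.digits x b)) (truncPoint n (Real.digits y b))) atTop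
      (𝓝 (quadForm (fun x y : Unit01 => sobolevKernel α x y) s c)) := by
    unfold quadForm
    refine tendsto_finsetSum _ fun x _ => tendsto_finsetSum _ fun y _ => Tendsto.const_mul _ ?_
    have hx := tendsto_truncPoint (Real.digits x b)
    have hy := tendsto_truncPoint (Real.digits y b)
    rw [Real.ofDigits_digits hb x.2] at hx
    rw [Real.ofDigits_digits hb y.2] at hy
    exact tendsto_uncurry (continuous_sobolevKernel hα) hx hy
  have hbd := (((tendsto_mesh_error hb M ((∑ i ∈ s, c i) ^ 2)).const_mul 2).add_const
    (2 * (M ^ 2 * E * quadForm (fun x y : Unit01 => ddotKernel b α τ ζ x y) s c))).const_mul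
    ((α : ℝ) + 1)
  refine (le_of_tendsto_of_tendsto' hlim hbd fun n => ?_).trans_eq (by ring)
  have := sum_sobolevKernel_le hα hM1 hM2 s c {0}
    (fun _ x => truncPoint n (Real.digits x b)) (fun F hF => by
      rw [Finset.sum_singleton]
      exact sq_sum_feature_le hb hF n s c (fun x => Real.digits x b) hE hQ)
  rw [Finset.sum_singleton] at this
  exact this

/-! ### The digitally shift-invariant kernel -/

theorem integral_floor_eq_sum (g : ℕ → ℝ) {N : ℕ} (hN : 0 < N) :
    ∫ σ in Set.Ico (0 : ℝ) 1, g ⌊σ * N⌋₊ = (N : ℝ)⁻¹ * ∑ j ∈ Finset.range N, g j := by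
  have hN0 : (N : ℝ) ≠ 0 := by positivity
  have hfl : ∀ j : ℕ, Set.EqOn (fun _ => g j) (fun τ : ℝ => g ⌊τ⌋₊)
      (Set.uIoo (j : ℝ) ((j + 1 : ℕ) : ℝ)) := by
    intro j τ hτ
    rw [Set.uIoo_of_le (by simp)] at hτ
    have : ⌊τ⌋₊ = j := (Nat.floor_eq_iff (j.cast_nonneg.trans hτ.1.le)).2
      ⟨hτ.1.le, by simpa using hτ.2⟩
    simp only [this]
  have hint : ∀ j < N, IntervalIntegrable (fun τ : ℝ => g ⌊τ⌋₊) MeasureTheory.volume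
      (j : ℝ) ((j + 1 : ℕ) : ℝ) := fun j _ =>
    (intervalIntegrable_const (c := g j)).congr_uIoo (hfl j)
  rw [MeasureTheory.integral_Ico_eq_integral_Ioc, ← intervalIntegral.integral_of_le zero_le_one,
    intervalIntegral.integral_comp_mul_right (fun τ => g ⌊τ⌋₊) hN0, zero_mul, one_mul, smul_eq_mul]
  have := intervalIntegral.sum_integral_adjacent_intervals hint
  rw [Nat.cast_zero] at this
  rw [← this]
  congr 1
  refine Finset.sum_congr rfl fun j _ => ?_
  rw [← intervalIntegral.integral_congr_uIoo (hfl j)]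
  simp

theorem digits_eq_gridDigits {b : ℕ} [NeZero b] (σ : ℝ) {n ℓ : ℕ} (hℓ : ℓ < n) :
    Real.digits σ b ℓ = gridDigits b n ⌊σ * ((b ^ n : ℕ) : ℝ)⌋₊ ℓ := by
  have hb0 : (b : ℝ) ≠ 0 := by exact_mod_cast NeZero.ne b
  rw [Real.digits, gridDigits, ← Nat.floor_div_natCast]
  congr 2
  have : n = (ℓ + 1) + (n - 1 - ℓ) := by omega
  push_cast
  conv_rhs => rw [this, pow_add]
  rw [show ℓ + 1 + (n - 1 - ℓ) - 1 - ℓ = n - 1 - ℓ by omega]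
  field_simp

/-- The first `n` digits of `σ` depend only on its cell of length `b⁻ⁿ`, so truncating the points
turns the shift integral into an exact grid average; dominated convergence gives the limit. -/
theorem tendsto_quadForm_dsiKernel {b : ℕ} [NeZero b] {K : ℝ → ℝ → ℝ}
    (hK : Continuous fun p : ℝ × ℝ => K p.1 p.2) (s : Finset Unit01) (c : Unit01 → ℝ) :
    Tendsto (fun n => ((b : ℝ) ^ n)⁻¹ * ∑ j ∈ Finset.range (b ^ n), ∑ x ∈ s, ∑ y ∈ s, c x * c y *
      K (truncPoint n (Real.digits x b + gridDigits b n j))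
        (truncPoint n (Real.digits y b + gridDigits b n j))) atTop
      (𝓝 (quadForm (fun x y : Unit01 => dsiKernel b K x y) s c)) := by
  have hswap : ∀ n, ((b : ℝ) ^ n)⁻¹ * ∑ j ∈ Finset.range (b ^ n), ∑ x ∈ s, ∑ y ∈ s, c x * c y *
      K (truncPoint n (Real.digits x b + gridDigits b n j))
        (truncPoint n (Real.digits y b + gridDigits b n j))
      = ∑ x ∈ s, ∑ y ∈ s, c x * c y * (((b : ℝ) ^ n)⁻¹ * ∑ j ∈ Finset.range (b ^ n),
      K (truncPoint n (Real.digits x b + gridDigits b n j))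
        (truncPoint n (Real.digits y b + gridDigits b n j))) := by
    intro n
    rw [Finset.sum_comm, Finset.mul_sum]
    refine Finset.sum_congr rfl fun x _ => ?_
    rw [Finset.sum_comm, Finset.mul_sum]
    refine Finset.sum_congr rfl fun y _ => ?_
    rw [← Finset.mul_sum]
    ring
  simp_rw [hswap]
  refine tendsto_finsetSum _ fun x _ => tendsto_finsetSum _ fun y _ => Tendsto.const_mul _ ?_
  obtain ⟨B, hB⟩ := (isCompact_Icc.prod isCompact_Icc :
    IsCompact (Set.Icc (0 : ℝ) 1 ×ˢ Set.Icc (0 : ℝ) 1)).exists_bound_of_continuousOn hK.continuousOn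
  have hgrid : ∀ n (x : ℝ) σ, truncPoint n (Real.digits x b + Real.digits σ b)
      = truncPoint n (Real.digits x b + gridDigits b n ⌊σ * ((b ^ n : ℕ) : ℝ)⌋₊) := fun n x σ =>
    truncPoint_congr fun ℓ hℓ => by
      rw [Pi.add_apply, Pi.add_apply, digits_eq_gridDigits σ hℓ]
  have hdom := MeasureTheory.tendsto_integral_of_dominated_convergence
    (μ := MeasureTheory.volume.restrict (Set.Ico (0 : ℝ) 1))
    (F := fun n σ => K (truncPoint n (Real.digits x b + Real.digits σ b))
      (truncPoint n (Real.digits y b + Real.digits σ b)))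
    (f := fun σ => K (digitAdd b x σ) (digitAdd b y σ)) (fun _ => B)
    (fun n => ?_) (MeasureTheory.integrable_const B) (fun n => ?_) ?_
  · refine hdom.congr fun n => ?_
    simp_rw [hgrid]
    rw [integral_floor_eq_sum (fun j => K (truncPoint n (Real.digits x b + gridDigits b n j))
      (truncPoint n (Real.digits y b + gridDigits b n j))) (Nat.pow_pos (NeZero.pos b))]
    push_cast
    rfl
  · simp_rw [hgrid]
    exact ((measurable_from_top (f := fun j : ℕ =>
      K (truncPoint n (Real.digits x b + gridDigits b n j))
        (truncPoint n (Real.digits y b + gridDigits b n j)))).comp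
      (Nat.measurable_floor.comp (measurable_id.mul_const _))).aestronglyMeasurable
  · exact Eventually.of_forall fun σ => hB (_, _) ⟨truncPoint_mem_Icc _ _, truncPoint_mem_Icc _ _⟩
  · exact Eventually.of_forall fun σ => tendsto_uncurry hK (tendsto_truncPoint _) (tendsto_truncPoint _)

theorem quadForm_dsiKernel_le {b : ℕ} [NeZero b] (hb : 1 < b) {α : ℕ} (hα : 2 ≤ α) :
    ∃ C, 0 ≤ C ∧ ∀ s c, quadForm (fun x y : Unit01 => dsiKernel b (sobolevKernel α) x y) s c
      ≤ C * quadForm (fun x y : Unit01 => dotKernel b α x y) s c := by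
  obtain ⟨M, hM0, hM1, hM2⟩ := exists_isFeature hb hα
  refine ⟨(α + 1) * M ^ 2, by positivity, fun s c => ?_⟩
  have hQ := hasSum_quadForm_walshKernel hb (summable_dotWeightSq hb hα) s c
  have hlim := tendsto_quadForm_dsiKernel (b := b) (continuous_sobolevKernel hα) s c
  have hbd := ((tendsto_mesh_error hb M ((∑ i ∈ s, c i) ^ 2)).add_const
    (M ^ 2 * quadForm (fun x y : Unit01 => dotKernel b α x y) s c)).const_mul ((α : ℝ) + 1)
  refine (le_of_tendsto_of_tendsto' hlim hbd fun n => ?_).trans_eq (by ring)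
  have hb0 : (0 : ℝ) < (b : ℝ) ^ n := by positivity
  rw [inv_mul_le_iff₀ hb0, mul_left_comm]
  exact sum_sobolevKernel_le hα hM1 hM2 s c (Finset.range (b ^ n))
    (fun j x => truncPoint n (Real.digits x b + gridDigits b n j)) fun F hF =>
      sum_sq_shift_feature_le hb hF n s c (fun x => Real.digits x b) hQ

end DSI

/-! ### Assembly of the summability claims and the inclusions -/

theorem mainTheorem2 (b : ℕ) [Fact b.Prime] (α : ℕ) (hα : 2 ≤ α) :
    -- the series that define the kernels `K̇_α` and `K̈_{α,τ,ζ}` converge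
    (Summable fun k : ℕ+ => DSI.dotWeightSq b α k) ∧
    (∀ τ ζ : ℝ, -1 < τ → -1 ≤ ζ → Summable fun k : ℕ+ => DSI.ddotWeightSq b α τ ζ k) ∧
    -- the inclusions, for all parameters for which `K̈_{α,τ,ζ}` is defined
    DSI.rkhs01 (DSI.dsiKernel b (DSI.sobolevKernel α)) ⊆ DSI.rkhs01 (DSI.dotKernel b α) ∧
    (∀ τ ζ : ℝ, τ < 1 → ζ ≤ 1 → (Summable fun k : ℕ+ => DSI.ddotWeightSq b α τ ζ k) →
      DSI.rkhs01 (DSI.dotKernel b α) ⊆ DSI.rkhs01 (DSI.ddotKernel b α τ ζ) ∧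
      DSI.rkhs01 (DSI.sobolevKernel α) ⊆ DSI.rkhs01 (DSI.ddotKernel b α τ ζ)) ∧
    (∀ τ₁ τ₂ ζ₁ ζ₂ : ℝ, τ₁ < 1 → τ₂ < 1 → ζ₁ ≤ 1 → ζ₂ ≤ 1 → τ₂ ≤ τ₁ → ζ₂ ≤ ζ₁ →
      (Summable fun k : ℕ+ => DSI.ddotWeightSq b α τ₂ ζ₂ k) →
      DSI.rkhs01 (DSI.ddotKernel b α τ₁ ζ₁) ⊆ DSI.rkhs01 (DSI.ddotKernel b α τ₂ ζ₂)) := by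
  have hb : 1 < b := (Fact.out : b.Prime).one_lt
  refine ⟨DSI.summable_dotWeightSq hb hα, fun τ ζ hτ hζ => DSI.summable_ddotWeightSq hb hα hτ hζ,
    ?_, fun τ ζ hτ hζ hw => ⟨?_, ?_⟩, fun τ₁ τ₂ ζ₁ ζ₂ _ _ _ _ hτ hζ hw => ?_⟩
  · obtain ⟨C, hC, h⟩ := DSI.quadForm_dsiKernel_le hb hα
    exact DSI.rkhs01_subset_walshKernel hb (DSI.dotWeightSq_nonneg b α)
      (DSI.summable_dotWeightSq hb hα) C hC h
  · exact DSI.rkhs01_walshKernel_subset hb (DSI.dotWeightSq_nonneg b α)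
      (DSI.dotWeightSq_le_ddotWeightSq hb hα hτ.le hζ) hw
  · obtain ⟨C, hC, h⟩ := DSI.quadForm_sobolevKernel_le hb hα hτ hζ hw
    exact DSI.rkhs01_subset_walshKernel hb (DSI.ddotWeightSq_nonneg b α τ ζ) hw C hC h
  · exact DSI.rkhs01_walshKernel_subset hb (DSI.ddotWeightSq_nonneg b α τ₁ ζ₁)
      (DSI.ddotWeightSq_anti hb α hτ hζ) hw
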